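/- **Theorem (boundedness implies consensus or global optimization).** Let $N\ge 1$, let $S\subset\mathbb R^d$ be closed, and let $f:\mathbb R^d\to\mathbb R\cup\{+\infty\}$ be Borel measurable with effective domain $\{f<+\infty\}=S$. Let $\bar\gamma^1\in(0,1)$ and $\bar\gamma^2\ge 0$ satisfy $(1-\bar\gamma^1+\bar\gamma^2)^2\le\frac12$. Let $x_0^1,\dots,x_0^N$ be (random or deterministic) initial positions that lie in $S$ almost surely, and let $\eta_n^i$ ($n\ge 0$, $1\le i\le N$) be i.i.d. $d$-dimensional standard normal vectors, jointly independent of the initial positions. Define the fully isotropic DCBO iterates, for $n\ge 0$, by $$p_n=x_n^{i_n},\qquad i_n=\min\Big\{i : f(x_n^i)=\min_{1\le j\le N} f(x_n^j)\Big\},$$ $$x_{n+1}^i=\mathcal P\Big(x_n^i+\bar\gamma^1(p_n-x_n^i)+\bar\gamma^2\|p_n-x_n^i\|\tfrac{\eta_n^i}{\sqrt d}\Big),\qquad 1\le i\le N,$$ where $\mathcal P$ is the Euclidean metric projection onto $S$ if $S$ is convex, and the identity otherwise. A sample path reaches a *consensus* if $\|x_n^i-x_n^j\|\to 0$ as $n\to\infty$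 for all $i,j$. Let $f^*\in[-\infty,+\infty]$ be the essential infimum of $f$ with respect to Lebesgue measure. 1. For almost every sample path for which the initial sublevel set $\{x\in S: f(x)\le\min_i f(x_0^i)\}$ is bounded, the limit $\lim_{n\to\infty}f(p_n)$ exists in $[-\infty,+\infty]$, and either $\lim_{n\to\infty}f(p_n)\le f^*$ or the path reaches a consensus. 2. In particular, if $f$ is continuous on $S$ with a unique global minimizer $x^*\in S$ and $f^*=f(x^*)$, then almost every sample path for which the initial sublevel set is bounded reaches a consensus. -/

import Mathlib

open MeasureTheory ProbabilityTheory Filter Topology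

namespace DCBO

noncomputable section

/-- `ℝᵈ` with the Euclidean norm. -/
abbrev Space (d : ℕ) : Type := EuclideanSpace ℝ (Fin d)

open Classical in
/-- The metric projection onto `S`: the point of `S` nearest to `y`. It exists and is unique when
`S` is nonempty, closed and convex; where there is no nearest point the value is `y`. -/
def metricProj {d : ℕ} (S : Set (Space d)) (y : Space d) : Space d :=
  if h : ∃ z ∈ S, ∀ w ∈ S, ‖y - z‖ ≤ ‖y - w‖ then h.choose else y

/-- On a nonempty closed convex set, `metricProj` is a point of the set at minimal distance. -/
theorem metricProj_spec {d : ℕ} {S : Set (Space d)} (hne : S.Nonempty) (hcl : IsClosed S)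
    (y : Space d) :
    metricProj S y ∈ S ∧ ∀ w ∈ S, ‖y - metricProj S y‖ ≤ ‖y - w‖ := by
  have h : ∃ z ∈ S, ∀ w ∈ S, ‖y - z‖ ≤ ‖y - w‖ := by
    obtain ⟨z, hz, hd⟩ := hcl.exists_infDist_eq_dist hne y
    refine ⟨z, hz, fun w hw => ?_⟩
    rw [← dist_eq_norm, ← dist_eq_norm, ← hd]
    exact Metric.infDist_le_dist_of_mem hw
  rw [metricProj, dif_pos h]
  exact h.choose_spec

/-- Some agent has the smallest objective value. -/
theorem exists_best {d N : ℕ} [NeZero N] (f : Space d → EReal) (x : Fin N → Space d) :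
    ∃ i, ∀ j, f (x i) ≤ f (x j) :=
  Finite.exists_min fun i => f (x i)

open Classical in
/-- The smallest index among the agents with the smallest objective value. -/
def bestIndex {d N : ℕ} [NeZero N] (f : Space d → EReal) (x : Fin N → Space d) : Fin N :=
  (Finset.univ.filter fun i => ∀ j, f (x i) ≤ f (x j)).min' (by
    obtain ⟨i, hi⟩ := exists_best f x
    exact ⟨i, by simpa using hi⟩)

/-- The current best point (consensus point) of the configuration `x`. -/
def best {d N : ℕ} [NeZero N] (f : Space d → EReal) (x : Fin N → Space d) : Space d :=
  x (bestIndex f x)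

/-- The isotropic diffusion map
`F(x, y, η) = x + γ₁ (y - x) + γ₂ ‖y - x‖ η / √d`. -/
def isoMap {d : ℕ} (γ₁ γ₂ : ℝ) (x y η : Space d) : Space d :=
  x + γ₁ • (y - x) + (γ₂ * ‖y - x‖) • ((Real.sqrt d)⁻¹ • η)

open Classical in
/-- The correction applied after each move: the projection onto `S` if `S` is convex,
nothing otherwise. -/
def correct {d : ℕ} (S : Set (Space d)) (y : Space d) : Space d :=
  if Convex ℝ S then metricProj S y else y

/-- The fully isotropic DCBO iterates `(x_n^i)` for given initial positions `x0` and a given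
realization `η` of the noise. -/
def iterates {d N : ℕ} [NeZero N] (f : Space d → EReal) (S : Set (Space d)) (γ₁ γ₂ : ℝ)
    (x0 : Fin N → Space d) (η : ℕ → Fin N → Space d) : ℕ → Fin N → Space d
  | 0 => x0
  | n + 1 => fun i =>
      correct S (isoMap γ₁ γ₂ (iterates f S γ₁ γ₂ x0 η n i)
        (best f (iterates f S γ₁ γ₂ x0 η n)) (η n i))

/-- A sample path reaches a consensus: all mutual distances tend to zero. -/
def Consensus {d N : ℕ} (X : ℕ → Fin N → Space d) : Prop :=
  ∀ i j, Tendsto (fun n => ‖X n i - X n j‖) atTop (𝓝 0)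

/-- The sublevel set `{x ∈ S : f x ≤ min_i f (x0 i)}` of the initial configuration. -/
def initialSublevel {d N : ℕ} (f : Space d → EReal) (S : Set (Space d))
    (x0 : Fin N → Space d) : Set (Space d) :=
  {x ∈ S | f x ≤ ⨅ i, f (x0 i)}

/-- The random input of the algorithm: random initial positions `x0 i` in `S`, and noises
`η n i` that are i.i.d. `d`-dimensional standard normal vectors, jointly independent of the
initial positions. -/
structure IsInput {d N : ℕ} {Ω : Type*} [MeasurableSpace Ω] (P : Measure Ω) (S : Set (Space d))
    (x0 : Ω → Fin N → Space d) (η : ℕ → Fin N → Ω → Space d) : Prop where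
  measurable_init : Measurable x0
  init_mem : ∀ᵐ ω ∂P, ∀ i, x0 ω i ∈ S
  measurable_noise : ∀ n i, Measurable (η n i)
  noise_law : ∀ n i, P.map (η n i) = stdGaussian (Space d)
  noise_indep : iIndepFun (fun q : ℕ × Fin N => η q.1 q.2) P
  init_indep_noise : IndepFun x0 (fun ω (n : ℕ) (i : Fin N) => η n i ω) P

end

end DCBO

namespace DCBO

open scoped ENNReal RealInnerProductSpace

/-! On almost every path with bounded initial sublevel set the agents reach a consensus, and both
parts of the theorem follow from this together with the monotonicity of the best value. The proof
uses a Lyapunov function `spread + H * improveVol`. Write `p` for the best point and `D` for the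
distance of an agent to `p`.

If `p` stood still, each step would multiply `D` by at most `factor`, whose `d`-th moment is at most
`(5/6)^(d/2) < 1` (`lintegral_factor_pow_le`). Hence the `d`-th powers in `spread` contract in
expectation, and only the motion of `p` can spoil this.

The point `p` moves only when a proposal falls into `improveSet`. Let `v` be the volume of the
improving proposals within distance `k * D` of `p`. A proposal has density at most of order
`D^(-d)`, so, apart from a small Gaussian tail, the expected `d`-th power of the jump is at most a
multiple of `v`. It has density at least of order `D^(-d)` on the same ball, and an agent that lands
on an improving point removes all improving points that are no better, on average half of them. So
the expected loss of `improveVol` is at least a multiple of `v^2 / D^d` (`exists_improveVol_drop`).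
The inequality `v ≤ r * D^d + v^2 / (r * D^d)` then bounds the jump by a small multiple of `D^d`
plus a multiple of the lost volume (`exists_lintegral_moveFun_add_le`).

Boundedness of the sublevel set bounds the jump by `2 * R`. For distant agents this is already small
relative to `D`, so only the volume in a fixed ball matters and the Lyapunov function is finite.
Summing `exists_lyapunov` over time makes the total expected spread finite on each event with
bounded initial data; hence the spread tends to zero almost surely. -/

/-! ### Gaussian density: comparison with Lebesgue measure and an exponential moment. -/

/-- Tonelli's theorem for products of functions of separate coordinates. -/
theorem lintegral_ofReal_fintype_prod {ι : Type*} [Fintype ι] {E : Type*} [MeasurableSpace E]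
    {μ : ι → Measure E} [∀ i, SigmaFinite (μ i)] {g : ι → E → ℝ}
    (hg : ∀ i, Integrable (g i) (μ i)) (hg0 : ∀ i x, 0 ≤ g i x) :
    ∫⁻ x, ENNReal.ofReal (∏ i, g i (x i)) ∂(Measure.pi μ)
      = ∏ i, ∫⁻ x, ENNReal.ofReal (g i x) ∂(μ i) := by
  rw [← ofReal_integral_eq_lintegral_ofReal (Integrable.fintype_prod hg)
    (ae_of_all _ fun x => Finset.prod_nonneg fun i _ => hg0 i (x i)),
    integral_fintype_prod_eq_prod, ENNReal.ofReal_prod_of_nonneg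
      (fun i _ => integral_nonneg (hg0 i))]
  refine Finset.prod_congr rfl fun i _ => ?_
  rw [ofReal_integral_eq_lintegral_ofReal (hg i) (ae_of_all _ (hg0 i))]

theorem pi_gaussianReal_eq_withDensity (ι : Type*) [Fintype ι] :
    Measure.pi (fun _ : ι => gaussianReal 0 1)
      = (volume : Measure (ι → ℝ)).withDensity
          (fun x => ENNReal.ofReal (∏ i, gaussianPDFReal 0 1 (x i))) := by
  refine Measure.pi_eq fun s hs => ?_
  rw [withDensity_apply _ (MeasurableSet.univ_pi hs), volume_pi, Measure.restrict_pi_pi,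
    lintegral_ofReal_fintype_prod
      (fun i => (integrable_gaussianPDFReal 0 1).mono_measure Measure.restrict_le_self)
      (fun i x => gaussianPDFReal_nonneg 0 1 x)]
  refine Finset.prod_congr rfl fun i _ => ?_
  rw [gaussianReal_apply 0 one_ne_zero]
  rfl

/-- The density of the standard normal vector on `ℝᵈ`. -/
noncomputable def gaussDensity (d : ℕ) (e : Space d) : ℝ :=
  (Real.sqrt (2 * Real.pi))⁻¹ ^ d * Real.exp (-‖e‖ ^ 2 / 2)

theorem gaussDensity_nonneg {d : ℕ} (e : Space d) : 0 ≤ gaussDensity d e := by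
  unfold gaussDensity; positivity

theorem continuous_gaussDensity (d : ℕ) : Continuous (gaussDensity d) := by
  unfold gaussDensity; fun_prop

theorem stdGaussian_eq_withDensity (d : ℕ) :
    stdGaussian (Space d)
      = (volume : Measure (Space d)).withDensity (fun e => ENNReal.ofReal (gaussDensity d e)) := by
  rw [← map_pi_eq_stdGaussian, pi_gaussianReal_eq_withDensity]
  have hmp := PiLp.volume_preserving_toLp (Fin d)
  ext s hs
  rw [Measure.map_apply hmp.measurable hs, withDensity_apply _ (hmp.measurable hs),
    withDensity_apply _ hs, ← hmp.setLIntegral_comp_preimage hs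
      (continuous_gaussDensity d).measurable.ennreal_ofReal]
  refine lintegral_congr fun x => ?_
  congr 1
  simp only [gaussianPDFReal, gaussDensity, Finset.prod_mul_distrib, Finset.prod_const,
    Finset.card_univ, Fintype.card_fin, ← Real.exp_sum, EuclideanSpace.norm_sq_eq]
  simp [Finset.sum_div, Finset.sum_neg_distrib, neg_div]

theorem stdGaussian_le_volume (d : ℕ) :
    ∃ C : ℝ, 0 < C ∧ ∀ s : Set (Space d), MeasurableSet s →
      stdGaussian (Space d) s ≤ ENNReal.ofReal C * volume s := by
  refine ⟨(Real.sqrt (2 * Real.pi))⁻¹ ^ d, by positivity, fun s hs => ?_⟩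
  rw [stdGaussian_eq_withDensity, withDensity_apply _ hs, ← setLIntegral_const]
  refine lintegral_mono fun e => ENNReal.ofReal_le_ofReal ?_
  refine mul_le_of_le_one_right (by positivity) (Real.exp_le_one_iff.2 ?_)
  have := sq_nonneg ‖e‖
  linarith

/-- The density is bounded below only on bounded sets, hence the restriction to a ball. With
`stdGaussian_le_volume` this gives the two-sided comparison behind the proposal estimates. -/
theorem le_lintegral_stdGaussian (d : ℕ) (K : ℝ) :
    ∃ c : ℝ, 0 < c ∧ ∀ g : Space d → ℝ≥0∞, Measurable g →
      ENNReal.ofReal c * ∫⁻ e in Metric.closedBall 0 K, g e ≤ ∫⁻ e, g e ∂(stdGaussian (Space d)) := by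
  refine ⟨(Real.sqrt (2 * Real.pi))⁻¹ ^ d * Real.exp (-K ^ 2 / 2), by positivity, fun g hg => ?_⟩
  have hm := (continuous_gaussDensity d).measurable.ennreal_ofReal
  rw [stdGaussian_eq_withDensity, lintegral_withDensity_eq_lintegral_mul _ hm hg,
    ← lintegral_const_mul _ hg]
  refine le_trans ?_ (setLIntegral_le_lintegral (Metric.closedBall 0 K) _)
  refine setLIntegral_mono (hm.mul hg) fun e he => ?_
  refine mul_le_mul_left (ENNReal.ofReal_le_ofReal ?_) _
  refine mul_le_mul_of_nonneg_left (Real.exp_le_exp.2 ?_) (by positivity)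
  have h1 : ‖e‖ ≤ K := by simpa using he
  have h2 : ‖e‖ ^ 2 ≤ K ^ 2 := pow_le_pow_left₀ (norm_nonneg e) h1 2
  linarith

/-- The rate `1/5` lies between `1/(2e)`, needed for `max_one_le_exp`, and `1/4`, above which the
moment, multiplied by `(1/2)^(d/2)`, would no longer be below one. -/
theorem lintegral_exp_norm_sq_stdGaussian (d : ℕ) :
    ∫⁻ e, ENNReal.ofReal (Real.exp (‖e‖ ^ 2 / 5)) ∂(stdGaussian (Space d))
      = ENNReal.ofReal (Real.sqrt (5 / 3) ^ d) := by
  have hm := (continuous_gaussDensity d).measurable.ennreal_ofReal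
  rw [stdGaussian_eq_withDensity, lintegral_withDensity_eq_lintegral_mul _ hm (by fun_prop)]
  have h1 : ∀ e : Space d, (ENNReal.ofReal (gaussDensity d e))
      * ENNReal.ofReal (Real.exp (‖e‖ ^ 2 / 5))
      = ENNReal.ofReal ((Real.sqrt (2 * Real.pi))⁻¹ ^ d * Real.exp (-(3/10) * ‖e‖ ^ 2)) := by
    intro e
    rw [← ENNReal.ofReal_mul (gaussDensity_nonneg e), gaussDensity, mul_assoc, ← Real.exp_add]
    congr 3
    ring
  simp only [Pi.mul_apply, h1]
  have h2 := GaussianFourier.integral_rexp_neg_mul_sq_norm (V := Space d)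
    (b := 3 / 10) (by norm_num)
  -- A non-integrable function would have integral zero, contradicting the positive closed form.
  have hint : Integrable (fun e : Space d => Real.exp (-(3/10) * ‖e‖ ^ 2)) := by
    by_contra hcon
    rw [integral_undef hcon] at h2
    have : 0 < (Real.pi / (3 / 10)) ^ ((Module.finrank ℝ (Space d) : ℝ) / 2) := by positivity
    linarith
  rw [← ofReal_integral_eq_lintegral_ofReal (hint.const_mul _) (ae_of_all _ fun e => by positivity),
    integral_const_mul, h2]
  congr 1
  rw [finrank_euclideanSpace_fin, div_eq_mul_inv (d : ℝ) 2, mul_comm (d : ℝ), Real.rpow_mul (by positivity),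
    Real.rpow_natCast, ← mul_pow]
  congr 1
  rw [← one_div (2 : ℝ), ← Real.sqrt_eq_rpow, ← Real.sqrt_inv, ← Real.sqrt_mul (by positivity)]
  congr 1
  field_simp
  norm_num

/-! ### The `d`-th moment of the expansion factor. -/

theorem max_one_le_exp {u : ℝ} (hu : 0 ≤ u) : max 1 u ≤ Real.exp (u ^ 2 / 5) := by
  refine max_le (Real.one_le_exp (by positivity)) ?_
  refine (pow_le_pow_iff_left₀ hu (Real.exp_pos _).le two_ne_zero).1 ?_
  rw [← Real.exp_nat_mul]
  -- The tangent at `t = 1` gives `exp t ≥ e * t`; it suffices because `2.7 * 2/5 ≥ 1`.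
  have h1 : 2.7 * (2 * u ^ 2 / 5) ≤ Real.exp (2 * u ^ 2 / 5) := by
    have h2 := Real.add_one_le_exp (2 * u ^ 2 / 5 - 1)
    have h3 : Real.exp (2 * u ^ 2 / 5) = Real.exp 1 * Real.exp (2 * u ^ 2 / 5 - 1) := by
      rw [← Real.exp_add]; congr 1; ring
    have h4 := Real.exp_one_gt_d9
    rw [h3]
    have : (0:ℝ) ≤ 2 * u ^ 2 / 5 := by positivity
    nlinarith
  have : ((2 : ℕ) : ℝ) * (u ^ 2 / 5) = 2 * u ^ 2 / 5 := by push_cast; ring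
  rw [this]
  nlinarith [sq_nonneg u]

/-- The random expansion factor of the distance to the consensus point. -/
noncomputable def factor (d : ℕ) (γ₁ γ₂ : ℝ) (e : Space d) : ℝ :=
  (1 - γ₁) + γ₂ * (‖e‖ / Real.sqrt d)

theorem factor_nonneg {d : ℕ} {γ₁ γ₂ : ℝ} (h1 : γ₁ ≤ 1) (h2 : 0 ≤ γ₂) (e : Space d) :
    0 ≤ factor d γ₁ γ₂ e := by
  have : 0 ≤ 1 - γ₁ := by linarith
  unfold factor; positivity

theorem continuous_factor (d : ℕ) (γ₁ γ₂ : ℝ) : Continuous (factor d γ₁ γ₂) := by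
  unfold factor; fun_prop

/-- With `u = ‖e‖ / √d`, the factor is at most `(1 - γ₁ + γ₂) * max 1 u ≤ √(1/2) * exp (u^2/5)`. The
`d`-th power turns the exponential into `exp (‖e‖^2/5)`, and `1/2 * 5/3 = 5/6`. -/
theorem lintegral_factor_pow_le {d : ℕ} (hd : d ≠ 0) {γ₁ γ₂ : ℝ} (h1 : γ₁ ≤ 1) (h2 : 0 ≤ γ₂)
    (hγ : (1 - γ₁ + γ₂) ^ 2 ≤ 1 / 2) :
    ∫⁻ e, ENNReal.ofReal (factor d γ₁ γ₂ e ^ d) ∂(stdGaussian (Space d))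
      ≤ ENNReal.ofReal (Real.sqrt (5 / 6) ^ d) := by
  have hs : 1 - γ₁ + γ₂ ≤ Real.sqrt (1 / 2) := Real.le_sqrt_of_sq_le hγ
  have hp : ∀ e : Space d, factor d γ₁ γ₂ e ^ d
      ≤ Real.sqrt (1 / 2) ^ d * Real.exp (‖e‖ ^ 2 / 5) := by
    intro e
    set u := ‖e‖ / Real.sqrt d with hu
    have hu0 : 0 ≤ u := by positivity
    have h3 : factor d γ₁ γ₂ e ≤ Real.sqrt (1 / 2) * Real.exp (u ^ 2 / 5) := by
      calc factor d γ₁ γ₂ e ≤ (1 - γ₁ + γ₂) * max 1 u := by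
            have := le_max_left 1 u
            have := le_max_right 1 u
            unfold factor
            rw [← hu]
            have h5 : 0 ≤ 1 - γ₁ := by linarith
            nlinarith
        _ ≤ Real.sqrt (1 / 2) * Real.exp (u ^ 2 / 5) :=
            mul_le_mul hs (max_one_le_exp hu0) (by positivity) (by positivity)
    refine (pow_le_pow_left₀ (factor_nonneg h1 h2 e) h3 d).trans (le_of_eq ?_)
    rw [mul_pow, ← Real.exp_nat_mul, hu, div_pow, Real.sq_sqrt (by positivity)]
    congr 2
    field_simp
  calc ∫⁻ e, ENNReal.ofReal (factor d γ₁ γ₂ e ^ d) ∂(stdGaussian (Space d))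
      ≤ ∫⁻ e, ENNReal.ofReal (Real.sqrt (1 / 2) ^ d) * ENNReal.ofReal (Real.exp (‖e‖ ^ 2 / 5))
          ∂(stdGaussian (Space d)) := by
        refine lintegral_mono fun e => ?_
        rw [← ENNReal.ofReal_mul (by positivity)]
        exact ENNReal.ofReal_le_ofReal (hp e)
    _ = ENNReal.ofReal (Real.sqrt (5 / 6) ^ d) := by
        rw [lintegral_const_mul _ (by fun_prop), lintegral_exp_norm_sq_stdGaussian,
          ← ENNReal.ofReal_mul (by positivity), ← mul_pow, ← Real.sqrt_mul (by positivity)]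
        norm_num

/-! ### Nonexpansiveness of the correction. -/

section Correction

variable {d : ℕ} {S : Set (Space d)}

/-- Adding the obtuse-angle inequalities at the two projections gives `‖p - q‖^2 ≤ ⟪y - z, p - q⟫`;
Cauchy–Schwarz finishes. -/
theorem norm_metricProj_sub_le (hne : S.Nonempty) (hcl : IsClosed S) (hconv : Convex ℝ S)
    (y z : Space d) : ‖metricProj S y - metricProj S z‖ ≤ ‖y - z‖ := by
  have key : ∀ u : Space d, ∀ w ∈ S, ⟪u - metricProj S u, w - metricProj S u⟫ ≤ 0 := by
    intro u
    obtain ⟨h1, h2⟩ := metricProj_spec hne hcl u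
    refine (norm_eq_iInf_iff_real_inner_le_zero hconv h1).1 (le_antisymm ?_ ?_)
    · have : Nonempty S := hne.to_subtype
      exact le_ciInf fun w => h2 w w.2
    · exact ciInf_le ⟨0, by rintro _ ⟨w, rfl⟩; exact norm_nonneg _⟩ (⟨_, h1⟩ : S)
  have hy := key y _ (metricProj_spec hne hcl z).1
  have hz := key z _ (metricProj_spec hne hcl y).1
  set p := metricProj S y
  set q := metricProj S z
  have h1 : ‖p - q‖ ^ 2 ≤ ⟪y - z, p - q⟫ := by
    have e1 : ⟪y - p, q - p⟫ = -⟪y - p, p - q⟫ := by rw [← inner_neg_right, neg_sub]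
    have e2 : ⟪y - z, p - q⟫ = ⟪y - p, p - q⟫ + ⟪p - q, p - q⟫ - ⟪z - q, p - q⟫ := by
      rw [← inner_add_left, ← inner_sub_left]
      congr 1
      abel
    rw [e2, real_inner_self_eq_norm_sq]
    linarith
  have h2 : ⟪y - z, p - q⟫ ≤ ‖y - z‖ * ‖p - q‖ := real_inner_le_norm _ _
  by_contra hcon
  push Not at hcon
  have : 0 < ‖p - q‖ := (norm_nonneg _).trans_lt hcon
  nlinarith

theorem norm_correct_sub_le (hcl : IsClosed S) (y z : Space d) :
    ‖correct S y - correct S z‖ ≤ ‖y - z‖ := by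
  unfold correct
  split_ifs with hconv
  -- The empty set is convex; there `metricProj` takes its default value and is the identity.
  · rcases S.eq_empty_or_nonempty with rfl | hne
    · simp [metricProj]
    · exact norm_metricProj_sub_le hne hcl hconv y z
  · rfl

theorem correct_of_mem {y : Space d} (hy : y ∈ S) : correct S y = y := by
  unfold correct
  split_ifs with hconv
  · have h : ∃ z ∈ S, ∀ w ∈ S, ‖y - z‖ ≤ ‖y - w‖ := ⟨y, hy, by simp⟩
    rw [metricProj, dif_pos h]
    have := h.choose_spec.2 y hy
    rw [sub_self, norm_zero, norm_le_zero_iff, sub_eq_zero] at this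
    exact this.symm
  · rfl

theorem measurable_correct (hcl : IsClosed S) : Measurable (correct S) := by
  have : LipschitzWith 1 (correct S) :=
    LipschitzWith.of_dist_le_mul fun y z => by
      simpa [dist_eq_norm] using norm_correct_sub_le hcl y z
  exact this.continuous.measurable

theorem norm_correct_sub_le_of_mem (hcl : IsClosed S) {p : Space d} (hp : p ∈ S) (y : Space d) :
    ‖correct S y - p‖ ≤ ‖y - p‖ := by
  simpa [correct_of_mem hp] using norm_correct_sub_le hcl y p

end Correction

/-! ### The best agent and its measurability. -/

section Best

variable {d N : ℕ} [NeZero N] {f : Space d → EReal} {x : Fin N → Space d}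

theorem best_le (f : Space d → EReal) (x : Fin N → Space d) (j : Fin N) :
    f (best f x) ≤ f (x j) := by
  have := Finset.min'_mem (Finset.univ.filter fun i => ∀ j, f (x i) ≤ f (x j)) (by
    obtain ⟨i, hi⟩ := exists_best f x
    exact ⟨i, by simpa using hi⟩)
  exact (Finset.mem_filter.1 this).2 j

theorem bestIndex_le {i : Fin N} (h : f (x i) ≤ f (best f x)) : bestIndex f x ≤ i :=
  Finset.min'_le _ _ (by
    rw [Finset.mem_filter]
    exact ⟨Finset.mem_univ _, fun j => h.trans (best_le f x j)⟩)

theorem best_eq_iInf : ⨅ i, f (x i) = f (best f x) :=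
  le_antisymm (iInf_le _ _) (le_iInf fun i => best_le f x i)

/-- This expresses the choice of index through finitely many comparisons of values, from which
measurability is read off. -/
theorem bestIndex_eq_iff {i : Fin N} :
    bestIndex f x = i ↔ (∀ j, f (x i) ≤ f (x j)) ∧ ∀ k < i, ∃ j, f (x j) < f (x k) := by
  constructor
  · rintro rfl
    refine ⟨fun j => best_le f x j, fun k hk => ⟨bestIndex f x, ?_⟩⟩
    by_contra hcon
    exact absurd (bestIndex_le (not_lt.1 hcon)) (not_le.2 hk)
  · rintro ⟨h1, h2⟩
    refine le_antisymm (bestIndex_le (h1 _)) ?_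
    by_contra hcon
    obtain ⟨j, hj⟩ := h2 _ (not_le.1 hcon)
    exact absurd (best_le f x j) (not_le.2 hj)

theorem measurable_bestIndex (hf : Measurable f) :
    Measurable (bestIndex (N := N) f) := by
  refine measurable_to_countable' fun i => ?_
  have : bestIndex f ⁻¹' {i} = (⋂ j, {x : Fin N → Space d | f (x i) ≤ f (x j)}) ∩
      ⋂ k, ⋂ (_ : k < i), ⋃ j, {x : Fin N → Space d | f (x j) < f (x k)} := by
    ext x
    simp [bestIndex_eq_iff]
  rw [this]
  have hm : ∀ j, Measurable fun x : Fin N → Space d => f (x j) :=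
    fun j => hf.comp (measurable_pi_apply j)
  exact (MeasurableSet.iInter fun j => measurableSet_le (hm i) (hm j)).inter
    (MeasurableSet.iInter fun k => MeasurableSet.iInter fun _ => MeasurableSet.iUnion fun j =>
      measurableSet_lt (hm j) (hm k))

theorem measurable_best (hf : Measurable f) : Measurable (best (N := N) f) := by
  have h : Measurable fun q : (Fin N → Space d) × Fin N => q.1 q.2 :=
    measurable_from_prod_countable_left fun j => measurable_pi_apply j
  exact h.comp (measurable_id.prodMk (measurable_bestIndex hf))

end Best

/-! ### One step: monotonicity of the best value and of the improving proposals. -/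

section Step

variable {d N : ℕ} [NeZero N] {f : Space d → EReal} {S : Set (Space d)} {γ₁ γ₂ : ℝ}
  {x : Fin N → Space d}

/-- One step of the algorithm from the configuration `x` with noise `e`. -/
noncomputable def step (f : Space d → EReal) (S : Set (Space d)) (γ₁ γ₂ : ℝ)
    (x e : Fin N → Space d) : Fin N → Space d :=
  fun i => correct S (isoMap γ₁ γ₂ (x i) (best f x) (e i))

theorem isoMap_sub (x p e : Space d) :
    isoMap γ₁ γ₂ x p e - p = (1 - γ₁) • (x - p) + (γ₂ * ‖x - p‖ / Real.sqrt d) • e := by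
  rw [isoMap, norm_sub_rev p x, smul_smul, div_eq_mul_inv]
  module

theorem norm_isoMap_sub_le (h1 : γ₁ ≤ 1) (h2 : 0 ≤ γ₂) (x p e : Space d) :
    ‖isoMap γ₁ γ₂ x p e - p‖ ≤ factor d γ₁ γ₂ e * ‖x - p‖ := by
  rw [isoMap_sub]
  refine (norm_add_le _ _).trans (le_of_eq ?_)
  rw [norm_smul, norm_smul, Real.norm_of_nonneg (by linarith), Real.norm_of_nonneg (by positivity),
    factor]
  ring

theorem norm_step_sub_le (hcl : IsClosed S) (h1 : γ₁ ≤ 1) (h2 : 0 ≤ γ₂) (hp : best f x ∈ S)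
    (e : Fin N → Space d) (i : Fin N) :
    ‖step f S γ₁ γ₂ x e i - best f x‖ ≤ factor d γ₁ γ₂ (e i) * ‖x i - best f x‖ :=
  (norm_correct_sub_le_of_mem hcl hp _).trans (norm_isoMap_sub_le h1 h2 _ _ _)

/-- The best agent is at distance zero from the consensus point, so drift and noise both vanish.
This is why the best value never increases. -/
theorem step_bestIndex (hp : best f x ∈ S) (e : Fin N → Space d) :
    step f S γ₁ γ₂ x e (bestIndex f x) = best f x := by
  have : x (bestIndex f x) = best f x := rfl
  simp [step, isoMap, this, correct_of_mem hp]

theorem best_step_le (hp : best f x ∈ S) (e : Fin N → Space d) :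
    f (best f (step f S γ₁ γ₂ x e)) ≤ f (best f x) := by
  have := best_le f (step f S γ₁ γ₂ x e) (bestIndex f x)
  rwa [step_bestIndex hp] at this

/-- The proposals `y` of agent `j` that would make it the best agent, ties being resolved in favour
of the smaller index. -/
def improveSet (f : Space d → EReal) (S : Set (Space d)) (x : Fin N → Space d) (j : Fin N) :
    Set (Space d) :=
  {y | f (correct S y) < f (best f x) ∨ (f (correct S y) = f (best f x) ∧ j < bestIndex f x)}

theorem measurableSet_improveSet (hcl : IsClosed S) (hf : Measurable f) (j : Fin N) :
    MeasurableSet {q : (Fin N → Space d) × Space d | q.2 ∈ improveSet f S q.1 j} := by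
  have hb : Measurable fun q : (Fin N → Space d) × Space d => f (best f q.1) :=
    hf.comp ((measurable_best hf).comp measurable_fst)
  have hc : Measurable fun q : (Fin N → Space d) × Space d => f (correct S q.2) :=
    hf.comp ((measurable_correct hcl).comp measurable_snd)
  have hi : Measurable fun q : (Fin N → Space d) × Space d => bestIndex f q.1 :=
    (measurable_bestIndex hf).comp measurable_fst
  exact (measurableSet_lt hc hb).union
    ((measurableSet_eq_fun hc hb).inter (hi (measurableSet_Ioi (a := j))))

/-- The threshold value does not increase; if it stays equal, the old best agent still attains it,
so the best index does not increase either. -/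
theorem improveSet_step_subset (hp : best f x ∈ S) (e : Fin N → Space d) (k : Fin N) :
    improveSet f S (step f S γ₁ γ₂ x e) k ⊆ improveSet f S x k := by
  have hle := best_step_le (γ₁ := γ₁) (γ₂ := γ₂) hp e
  rintro y (hy | ⟨hy, hk⟩)
  · exact Or.inl (hy.trans_le hle)
  · rcases hle.lt_or_eq with h | h
    · exact Or.inl (hy.trans_lt h)
    · refine Or.inr ⟨hy.trans h, hk.trans_le (bestIndex_le ?_)⟩
      rw [step_bestIndex hp, h]

/-- If the best index changes without a strict gain in value, the old best agent is still optimal,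
so the new index is smaller. The tie clause of `improveSet` covers exactly this case. -/
theorem best_step_eq_or (hp : best f x ∈ S) (e : Fin N → Space d) :
    best f (step f S γ₁ γ₂ x e) = best f x ∨
      ∃ j, isoMap γ₁ γ₂ (x j) (best f x) (e j) ∈ improveSet f S x j ∧
        best f (step f S γ₁ γ₂ x e) = step f S γ₁ γ₂ x e j := by
  set x' := step f S γ₁ γ₂ x e with hx'
  have hle := best_step_le (γ₁ := γ₁) (γ₂ := γ₂) hp e
  rcases eq_or_ne (bestIndex f x') (bestIndex f x) with h | h
  · left
    rw [best, h, hx', step_bestIndex hp]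
  · refine Or.inr ⟨bestIndex f x', ?_, rfl⟩
    rcases hle.lt_or_eq with h1 | h1
    · exact Or.inl h1
    · refine Or.inr ⟨h1, lt_of_le_of_ne (bestIndex_le ?_) h⟩
      rw [← hx'] at h1
      rw [hx', step_bestIndex hp, ← hx', h1]

/-- The inequality is strict even for ties: if `z` equals the new best value and `j` precedes the
new best index, agent `j` itself cannot attain that value. -/
theorem lt_of_mem_improveSet_step {e : Fin N → Space d} {j : Fin N} {z : Space d}
    (hz : z ∈ improveSet f S (step f S γ₁ γ₂ x e) j) :
    f (correct S z) < f (correct S (isoMap γ₁ γ₂ (x j) (best f x) (e j))) := by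
  have hle : f (best f (step f S γ₁ γ₂ x e)) ≤ f (step f S γ₁ γ₂ x e j) := best_le f _ j
  rcases hz with hz | ⟨hz, hj⟩
  · exact hz.trans_le hle
  · rw [hz]
    refine lt_of_le_of_ne hle fun h => ?_
    exact absurd (bestIndex_le h.ge) (not_le.2 hj)

end Step

/-! ### The law of a single proposal: density bounds at scale `‖x - p‖`. -/

section Proposal

variable {d : ℕ} {γ₁ γ₂ : ℝ}

theorem lintegral_comp_affine (q : Space d) {s : ℝ} (hs : 0 < s) {h : Space d → ℝ≥0∞}
    (hh : Measurable h) :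
    ∫⁻ e, h (q + s • e) = ENNReal.ofReal ((s ^ d)⁻¹) * ∫⁻ y, h y := by
  have h1 : Measurable fun y : Space d => h (q + y) := hh.comp (measurable_const_add q)
  rw [← lintegral_map (f := fun y => h (q + y)) (g := fun e : Space d => s • e) h1
    (measurable_const_smul s), Measure.map_addHaar_smul _ hs.ne', lintegral_smul_measure,
    finrank_euclideanSpace_fin, abs_of_nonneg (by positivity), lintegral_add_left_eq_self,
    smul_eq_mul]

theorem isoMap_eq_affine (x p e : Space d) :
    isoMap γ₁ γ₂ x p e
      = (p + (1 - γ₁) • (x - p)) + (γ₂ / Real.sqrt d * ‖x - p‖) • e := by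
  rw [sub_eq_iff_eq_add'.1 (isoMap_sub (γ₁ := γ₁) (γ₂ := γ₂) x p e), ← add_assoc]
  congr 2
  ring

theorem continuous_isoMap (x p : Space d) : Continuous (isoMap γ₁ γ₂ x p) := by
  unfold isoMap; fun_prop

/-- Lebesgue measure pulled back by the proposal map. -/
theorem lintegral_comp_isoMap (hd : d ≠ 0) (h2 : 0 < γ₂) {x p : Space d} (hx : x ≠ p)
    {h : Space d → ℝ≥0∞} (hh : Measurable h) :
    ∫⁻ e, h (isoMap γ₁ γ₂ x p e)
      = ENNReal.ofReal (((γ₂ / Real.sqrt d) ^ d)⁻¹ / ‖x - p‖ ^ d) * ∫⁻ y, h y := by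
  have hD : 0 < ‖x - p‖ := norm_pos_iff.2 (sub_ne_zero.2 hx)
  have hd' : 0 < Real.sqrt d := Real.sqrt_pos.2 (by positivity)
  simp only [isoMap_eq_affine]
  rw [lintegral_comp_affine _ (by positivity) hh, mul_pow _ ‖x - p‖, mul_inv,
    div_eq_mul_inv _ (‖x - p‖ ^ d)]

/-- Noise of norm at most `K` keeps the proposal in the stated ball, and the affine change of
variables gives a density of at most `C / ‖x - p‖^d`. -/
theorem exists_measure_isoMap_le (hd : d ≠ 0) (h1 : γ₁ ≤ 1) (h2 : 0 < γ₂) (K : ℝ) :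
    ∃ C : ℝ, 0 < C ∧ ∀ (x p : Space d), x ≠ p → ∀ U : Set (Space d), MeasurableSet U →
      stdGaussian (Space d) {e | ‖e‖ ≤ K ∧ isoMap γ₁ γ₂ x p e ∈ U}
        ≤ ENNReal.ofReal (C / ‖x - p‖ ^ d) *
          volume (U ∩ Metric.closedBall p ((1 - γ₁ + γ₂ * (K / Real.sqrt d)) * ‖x - p‖)) := by
  have hd' : 0 < Real.sqrt d := Real.sqrt_pos.2 (by positivity)
  obtain ⟨C, hC, hCle⟩ := stdGaussian_le_volume d
  refine ⟨C * ((γ₂ / Real.sqrt d) ^ d)⁻¹, by positivity, fun x p hx U hU => ?_⟩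
  have hmeas : MeasurableSet {e | ‖e‖ ≤ K ∧ isoMap γ₁ γ₂ x p e ∈ U} :=
    (measurableSet_le measurable_norm measurable_const).inter
      ((continuous_isoMap x p).measurable hU)
  set Q := U ∩ Metric.closedBall p ((1 - γ₁ + γ₂ * (K / Real.sqrt d)) * ‖x - p‖) with hQ
  have hQm : MeasurableSet Q := hU.inter Metric.isClosed_closedBall.measurableSet
  have hsub : {e | ‖e‖ ≤ K ∧ isoMap γ₁ γ₂ x p e ∈ U} ⊆ isoMap γ₁ γ₂ x p ⁻¹' Q := by
    rintro e ⟨he, heU⟩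
    refine ⟨heU, ?_⟩
    rw [Metric.mem_closedBall, dist_eq_norm]
    refine (norm_isoMap_sub_le h1 h2.le x p e).trans ?_
    unfold factor
    gcongr
  calc stdGaussian (Space d) {e | ‖e‖ ≤ K ∧ isoMap γ₁ γ₂ x p e ∈ U}
      ≤ ENNReal.ofReal C * volume (isoMap γ₁ γ₂ x p ⁻¹' Q) :=
        (hCle _ hmeas).trans (by gcongr)
    _ = ENNReal.ofReal C * ∫⁻ e, Q.indicator 1 (isoMap γ₁ γ₂ x p e) := by
        rw [← lintegral_indicator_one ((continuous_isoMap x p).measurable hQm)]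
        rfl
    _ = _ := by
        rw [lintegral_comp_isoMap hd h2 hx (measurable_one.indicator hQm),
          lintegral_indicator_one hQm, ← mul_assoc, ← ENNReal.ofReal_mul hC.le, mul_div_assoc]

theorem exists_le_lintegral_isoMap (hd : d ≠ 0) (h1 : γ₁ ≤ 1) (h2 : 0 < γ₂) (k : ℝ) :
    ∃ c : ℝ, 0 < c ∧ ∀ (x p : Space d), x ≠ p → ∀ g : Space d → ℝ≥0∞, Measurable g →
      ENNReal.ofReal (c / ‖x - p‖ ^ d) * ∫⁻ y in Metric.closedBall p (k * ‖x - p‖), g y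
        ≤ ∫⁻ e, g (isoMap γ₁ γ₂ x p e) ∂(stdGaussian (Space d)) := by
  have hd' : 0 < Real.sqrt d := Real.sqrt_pos.2 (by positivity)
  have hs : 0 < γ₂ / Real.sqrt d := by positivity
  -- Noise that leads into the ball of radius `k * ‖x - p‖` has norm at most this number, whatever
  -- `x` and `p`; hence `c` is uniform.
  obtain ⟨c, hc, hcle⟩ := le_lintegral_stdGaussian d ((k + (1 - γ₁)) / (γ₂ / Real.sqrt d))
  refine ⟨c * ((γ₂ / Real.sqrt d) ^ d)⁻¹, by positivity, fun x p hx g hg => ?_⟩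
  have hD : 0 < ‖x - p‖ := norm_pos_iff.2 (sub_ne_zero.2 hx)
  refine le_trans ?_ (hcle _ (hg.comp (continuous_isoMap x p).measurable))
  have hB : MeasurableSet (Metric.closedBall p (k * ‖x - p‖)) :=
    Metric.isClosed_closedBall.measurableSet
  rw [mul_div_assoc, ENNReal.ofReal_mul hc.le, mul_assoc, ← lintegral_indicator hB,
    ← lintegral_comp_isoMap hd h2 hx (hg.indicator hB)]
  refine mul_le_mul_right ?_ _
  rw [← lintegral_indicator Metric.isClosed_closedBall.measurableSet]
  refine lintegral_mono fun e => ?_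
  by_cases he : isoMap γ₁ γ₂ x p e ∈ Metric.closedBall p (k * ‖x - p‖)
  · have hmem : e ∈ Metric.closedBall (0 : Space d) ((k + (1 - γ₁)) / (γ₂ / Real.sqrt d)) := by
      rw [mem_closedBall_zero_iff, le_div_iff₀ hs]
      rw [Metric.mem_closedBall, dist_eq_norm] at he
      have h3 : (γ₂ / Real.sqrt d * ‖x - p‖) • e
          = (isoMap γ₁ γ₂ x p e - p) - (1 - γ₁) • (x - p) := by
        rw [isoMap_eq_affine]; abel
      have h4 := norm_sub_le (isoMap γ₁ γ₂ x p e - p) ((1 - γ₁) • (x - p))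
      rw [← h3, norm_smul, norm_smul, Real.norm_of_nonneg (by positivity),
        Real.norm_of_nonneg (by linarith : 0 ≤ 1 - γ₁)] at h4
      refine le_of_mul_le_mul_right ?_ hD
      nlinarith
    rw [Set.indicator_of_mem he, Set.indicator_of_mem hmem]
  · rw [Set.indicator_of_notMem he]
    exact zero_le

end Proposal

/-! ### The expected loss of improving volume. -/

/-- Two independent points of `Q` are in a given weak order with probability at least `1/2`. -/
theorem measure_sq_le_two_mul_lintegral {E : Type*} [MeasurableSpace E] (μ : Measure E)
    [IsFiniteMeasure μ] {g : E → EReal} (hg : Measurable g) :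
    μ Set.univ ^ 2 ≤ 2 * ∫⁻ y, μ {z | g y ≤ g z} ∂μ := by
  have hA : MeasurableSet {q : E × E | g q.1 ≤ g q.2} :=
    measurableSet_le (hg.comp measurable_fst) (hg.comp measurable_snd)
  have hB : MeasurableSet {q : E × E | g q.2 ≤ g q.1} :=
    measurableSet_le (hg.comp measurable_snd) (hg.comp measurable_fst)
  have h1 : (μ.prod μ) {q : E × E | g q.1 ≤ g q.2} = ∫⁻ y, μ {z | g y ≤ g z} ∂μ :=
    Measure.prod_apply hA
  have h2 : (μ.prod μ) {q : E × E | g q.2 ≤ g q.1} = ∫⁻ y, μ {z | g y ≤ g z} ∂μ :=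
    Measure.prod_apply_symm hB
  calc μ Set.univ ^ 2 = (μ.prod μ) Set.univ := by
        rw [← Set.univ_prod_univ, Measure.prod_prod, sq]
    _ ≤ (μ.prod μ) ({q : E × E | g q.1 ≤ g q.2} ∪ {q : E × E | g q.2 ≤ g q.1}) :=
        measure_mono fun q _ => le_total (g q.1) (g q.2)
    _ ≤ _ := by
        rw [two_mul]
        exact (measure_union_le _ _).trans (by rw [h1, h2])

section Drop

variable {d N : ℕ} [NeZero N] {f : Space d → EReal} {S : Set (Space d)} {γ₁ γ₂ : ℝ}
  {x : Fin N → Space d}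

/-- The volume, within a ball, of the proposals that improve on the current best agent. -/
noncomputable def improveVol (f : Space d → EReal) (S : Set (Space d)) (ρ : ℝ)
    (x : Fin N → Space d) : ℝ≥0∞ :=
  ∑ k, volume (improveSet f S x k ∩ Metric.closedBall 0 ρ)

theorem measurable_improveVol (hcl : IsClosed S) (hf : Measurable f) (ρ : ℝ) :
    Measurable (improveVol (N := N) f S ρ) := by
  refine Finset.measurable_sum _ fun k _ => ?_
  have := (measurableSet_improveSet hcl hf k (N := N)).inter
    (measurable_snd (Metric.isClosed_closedBall (x := (0 : Space d)) (ε := ρ)).measurableSet)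
  exact measurable_measure_prodMk_left this

theorem measurableSet_improveSet_fixed (hcl : IsClosed S) (hf : Measurable f) (j : Fin N) :
    MeasurableSet (improveSet f S x j) :=
  measurable_prodMk_left (measurableSet_improveSet hcl hf j)

/-- Proposals no better than the new position of agent `j` have left its improving set by
`lt_of_mem_improveSet_step`; all other improving sets only shrink. -/
theorem improveVol_step_add_le (hcl : IsClosed S) (hf : Measurable f) (hp : best f x ∈ S) (ρ : ℝ)
    (e : Fin N → Space d) (j : Fin N) :
    improveVol f S ρ (step f S γ₁ γ₂ x e) +
      volume {z ∈ improveSet f S x j ∩ Metric.closedBall 0 ρ |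
        f (correct S (isoMap γ₁ γ₂ (x j) (best f x) (e j))) ≤ f (correct S z)}
      ≤ improveVol f S ρ x := by
  set x' := step f S γ₁ γ₂ x e
  set A := {z ∈ improveSet f S x j ∩ Metric.closedBall 0 ρ |
        f (correct S (isoMap γ₁ γ₂ (x j) (best f x) (e j))) ≤ f (correct S z)} with hA
  have hAm : MeasurableSet A :=
    ((measurableSet_improveSet_fixed hcl hf j).inter
      Metric.isClosed_closedBall.measurableSet).inter
      (measurableSet_le measurable_const (hf.comp (measurable_correct hcl)))
  unfold improveVol
  rw [← Finset.add_sum_erase _ _ (Finset.mem_univ j), add_right_comm,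
    ← Finset.add_sum_erase _ _ (Finset.mem_univ j)]
  refine add_le_add ?_ (Finset.sum_le_sum fun k _ => measure_mono
    (Set.inter_subset_inter_left _ (improveSet_step_subset hp e k)))
  rw [← measure_union _ hAm]
  · refine measure_mono (Set.union_subset
      (Set.inter_subset_inter_left _ (improveSet_step_subset hp e j)) fun z hz => hz.1)
  · rw [Set.disjoint_left]
    rintro z ⟨hz, -⟩ ⟨-, hz'⟩
    exact absurd (lt_of_mem_improveSet_step hz) (not_lt.2 hz')

theorem lintegral_improveVol_step_le (hcl : IsClosed S) (hf : Measurable f) (hp : best f x ∈ S)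
    (ρ : ℝ) (κ : Measure (Fin N → Space d)) [IsProbabilityMeasure κ] :
    ∫⁻ e, improveVol f S ρ (step f S γ₁ γ₂ x e) ∂κ ≤ improveVol f S ρ x := by
  refine (lintegral_mono fun e =>
    le_self_add.trans (improveVol_step_add_le hcl hf hp ρ e 0)).trans ?_
  simp

/-- The removed volume is averaged over the proposal of agent `j`. The lower density bound reduces
this to a double integral over `Q × Q`, where one point is no better than the other on at least half
of the product; this is the factor in `c / 2`. -/
theorem exists_improveVol_drop (hd : d ≠ 0) (hcl : IsClosed S) (hf : Measurable f) (h1 : γ₁ ≤ 1)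
    (h2 : 0 < γ₂) (k : ℝ) :
    ∃ c : ℝ, 0 < c ∧ ∀ (ρ : ℝ) (x : Fin N → Space d), best f x ∈ S →
      ∀ (κ : Measure (Fin N → Space d)) [IsProbabilityMeasure κ] (j : Fin N),
      κ.map (fun e => e j) = stdGaussian (Space d) → x j ≠ best f x →
      Metric.closedBall (best f x) (k * ‖x j - best f x‖) ⊆ Metric.closedBall 0 ρ →
      ∫⁻ e, improveVol f S ρ (step f S γ₁ γ₂ x e) ∂κ +
        ENNReal.ofReal (c / ‖x j - best f x‖ ^ d) *
          volume (improveSet f S x j ∩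
            Metric.closedBall (best f x) (k * ‖x j - best f x‖)) ^ 2
        ≤ improveVol f S ρ x := by
  obtain ⟨c, hc, hcle⟩ := exists_le_lintegral_isoMap hd h1 h2 k
  refine ⟨c / 2, by positivity, fun ρ x hp κ _ j hκ hx hρ => ?_⟩
  set p := best f x
  set D := ‖x j - p‖
  have hD : 0 < D := norm_pos_iff.2 (sub_ne_zero.2 hx)
  have hU : MeasurableSet (improveSet f S x j) := measurableSet_improveSet_fixed hcl hf j
  have hg : Measurable fun y => f (correct S y) := hf.comp (measurable_correct hcl)
  set G : Space d → ℝ≥0∞ := fun y => volume {z ∈ improveSet f S x j ∩ Metric.closedBall 0 ρ |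
        f (correct S y) ≤ f (correct S z)} with hGdef
  have hB : MeasurableSet (improveSet f S x j ∩ Metric.closedBall 0 ρ) :=
    hU.inter Metric.isClosed_closedBall.measurableSet
  have hG : Measurable G := by
    have : MeasurableSet {q : Space d × Space d |
        q.2 ∈ improveSet f S x j ∩ Metric.closedBall 0 ρ ∧
          f (correct S q.1) ≤ f (correct S q.2)} :=
      (measurable_snd hB).inter
        (measurableSet_le (hg.comp measurable_fst) (hg.comp measurable_snd))
    exact measurable_measure_prodMk_left this
  set Q := improveSet f S x j ∩ Metric.closedBall p (k * D) with hQ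
  have hQm : MeasurableSet Q := hU.inter Metric.isClosed_closedBall.measurableSet
  have hQB : Q ⊆ improveSet f S x j ∩ Metric.closedBall 0 ρ := Set.inter_subset_inter_right _ hρ
  have hfin : IsFiniteMeasure (volume.restrict Q) :=
    ⟨by
      rw [Measure.restrict_apply_univ]
      exact (measure_mono Set.inter_subset_right).trans_lt measure_closedBall_lt_top⟩
  have hkey : ENNReal.ofReal (c / 2 / D ^ d) * volume Q ^ 2
      ≤ ∫⁻ e, G (isoMap γ₁ γ₂ (x j) p (e j)) ∂κ := by
    calc ENNReal.ofReal (c / 2 / D ^ d) * volume Q ^ 2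
        ≤ ENNReal.ofReal (c / 2 / D ^ d) * (2 * ∫⁻ y in Q, G y) := by
          refine mul_le_mul_right ?_ _
          have := measure_sq_le_two_mul_lintegral (volume.restrict Q) hg
          rw [Measure.restrict_apply_univ] at this
          refine this.trans (mul_le_mul_right (lintegral_mono fun y => ?_) _)
          rw [Measure.restrict_apply (measurableSet_le measurable_const hg)]
          exact measure_mono fun z hz => ⟨hQB hz.2, hz.1⟩
      _ = ENNReal.ofReal (c / D ^ d) * ∫⁻ y in Q, G y := by
          rw [← mul_assoc]
          congr 1
          rw [← ENNReal.ofReal_ofNat, ← ENNReal.ofReal_mul (by positivity)]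
          congr 1
          ring
      _ ≤ ENNReal.ofReal (c / D ^ d) * ∫⁻ y in Metric.closedBall p (k * D), G y :=
          mul_le_mul_right (lintegral_mono_set Set.inter_subset_right) _
      _ ≤ ∫⁻ e, G (isoMap γ₁ γ₂ (x j) p e) ∂(stdGaussian (Space d)) := hcle _ _ hx G hG
      _ = _ := by
          rw [← hκ]
          exact lintegral_map (hG.comp (continuous_isoMap _ _).measurable) (measurable_pi_apply j)
  calc _ ≤ ∫⁻ e, improveVol f S ρ (step f S γ₁ γ₂ x e) ∂κ
        + ∫⁻ e, G (isoMap γ₁ γ₂ (x j) p (e j)) ∂κ := add_le_add le_rfl hkey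
    _ = ∫⁻ e, (improveVol f S ρ (step f S γ₁ γ₂ x e) + G (isoMap γ₁ γ₂ (x j) p (e j))) ∂κ :=
        (lintegral_add_right _ (hG.comp ((continuous_isoMap _ _).measurable.comp
          (measurable_pi_apply j)))).symm
    _ ≤ ∫⁻ _, improveVol f S ρ x ∂κ :=
        lintegral_mono fun e => improveVol_step_add_le hcl hf hp ρ e j
    _ = _ := by simp

end Drop

/-! ### Splitting a power of a sum, and a tail estimate. -/

/-- Either `t ≤ δ * s` or `s ≤ t / δ`, and one term on the right already suffices. The coefficient
of `s^d` can be brought close to one, as the contraction requires. -/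
theorem add_pow_le_mul_add_mul {s t δ : ℝ} (hs : 0 ≤ s) (ht : 0 ≤ t) (hδ : 0 < δ) (d : ℕ) :
    (s + t) ^ d ≤ (1 + δ) ^ d * s ^ d + (1 + 1 / δ) ^ d * t ^ d := by
  rw [← mul_pow, ← mul_pow]
  rcases le_total t (δ * s) with h | h
  · have h1 : (s + t) ^ d ≤ ((1 + δ) * s) ^ d := pow_le_pow_left₀ (by positivity) (by linarith) d
    have h2 : 0 ≤ ((1 + 1 / δ) * t) ^ d := by positivity
    linarith
  · have h3 : s ≤ 1 / δ * t := by
      rw [one_div, ← div_eq_inv_mul, le_div_iff₀ hδ]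
      linarith
    have h1 : (s + t) ^ d ≤ ((1 + 1 / δ) * t) ^ d :=
      pow_le_pow_left₀ (by positivity) (by linarith) d
    have h2 : 0 ≤ ((1 + δ) * s) ^ d := by positivity
    linarith

theorem exists_lintegral_norm_gt_le {E : Type*} [NormedAddCommGroup E] [MeasurableSpace E]
    [OpensMeasurableSpace E] {μ : Measure E} [IsFiniteMeasure μ] {g : E → ℝ≥0∞}
    (hg : ∫⁻ e, g e ∂μ ≠ ∞) {ε : ℝ} (hε : 0 < ε) :
    ∃ K : ℝ, 0 ≤ K ∧ ∫⁻ e in {e | K < ‖e‖}, g e ∂μ ≤ ENNReal.ofReal ε := by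
  have hmeas : ∀ n : ℕ, MeasurableSet {e : E | (n : ℝ) < ‖e‖} := fun n =>
    measurableSet_lt measurable_const measurable_norm
  have h0 : Tendsto (fun n : ℕ => μ {e : E | (n : ℝ) < ‖e‖}) atTop (𝓝 0) := by
    have h1 := tendsto_measure_iInter_atTop (μ := μ) (s := fun n : ℕ => {e : E | (n : ℝ) < ‖e‖})
      (fun n => (hmeas n).nullMeasurableSet)
      (fun m n hmn e he => lt_of_le_of_lt (Nat.cast_le.2 hmn : (m : ℝ) ≤ n) he) ⟨0, measure_ne_top _ _⟩
    have h2 : ⋂ n : ℕ, {e : E | (n : ℝ) < ‖e‖} = ∅ := by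
      ext e
      obtain ⟨n, hn⟩ := exists_nat_ge ‖e‖
      simp only [Set.mem_iInter, Set.mem_ofPred_eq, Set.mem_empty_iff_false, iff_false]
      exact fun h => absurd (h n) (not_lt.2 hn)
    rwa [h2, measure_empty] at h1
  have h3 := tendsto_setLIntegral_zero hg h0
  obtain ⟨n, hn⟩ := ((h3.eventually_lt_const (ENNReal.ofReal_pos.2 hε))).exists
  exact ⟨n, n.cast_nonneg, hn.le⟩

/-! ### The Lyapunov inequality for one step. -/

section OneStep

variable {d N : ℕ} [NeZero N] {f : Space d → EReal} {S : Set (Space d)} {γ₁ γ₂ : ℝ}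
  {x : Fin N → Space d}

/-- The truncated displacement of the consensus point caused by the proposal with noise `e` of
agent `j`. -/
noncomputable def moveFun (f : Space d → EReal) (S : Set (Space d)) (γ₁ γ₂ R : ℝ)
    (x : Fin N → Space d) (j : Fin N) : Space d → ℝ≥0∞ :=
  (isoMap γ₁ γ₂ (x j) (best f x) ⁻¹' improveSet f S x j).indicator
    fun e => ENNReal.ofReal ((min (2 * R) ‖isoMap γ₁ γ₂ (x j) (best f x) e - best f x‖) ^ d)

theorem measurable_moveFun (hcl : IsClosed S) (hf : Measurable f) (R : ℝ) (j : Fin N) :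
    Measurable (moveFun f S γ₁ γ₂ R x j) := by
  have hc : Continuous (isoMap γ₁ γ₂ (x j) (best f x)) := continuous_isoMap _ _
  refine Measurable.indicator ?_ (hc.measurable (measurableSet_improveSet_fixed hcl hf j))
  exact ((continuous_const.min (hc.sub continuous_const).norm).pow d).measurable.ennreal_ofReal

theorem moveFun_le {R : ℝ} (hR : 0 ≤ R) (h1 : γ₁ ≤ 1) (h2 : 0 ≤ γ₂) (j : Fin N) (e : Space d) :
    moveFun f S γ₁ γ₂ R x j e
      ≤ ENNReal.ofReal ((min (2 * R) (factor d γ₁ γ₂ e * ‖x j - best f x‖)) ^ d) := by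
  rw [moveFun]
  by_cases he : e ∈ isoMap γ₁ γ₂ (x j) (best f x) ⁻¹' improveSet f S x j
  · rw [Set.indicator_of_mem he]
    exact ENNReal.ofReal_le_ofReal (pow_le_pow_left₀ (le_min (by linarith) (norm_nonneg _))
      (min_le_min_left _ (norm_isoMap_sub_le h1 h2 _ _ _)) d)
  · rw [Set.indicator_of_notMem he]
    exact zero_le

/-- The noise is split at norm `K`: below it the jump is bounded and only the probability of
improving matters; above it the tail of the `d`-th moment of the factor is used. -/
theorem lintegral_moveFun_le (hcl : IsClosed S) (hf : Measurable f) {R : ℝ} (hR : 0 ≤ R)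
    (h1 : γ₁ ≤ 1) (h2 : 0 ≤ γ₂) (j : Fin N) (K : ℝ) :
    ∫⁻ e, moveFun f S γ₁ γ₂ R x j e ∂(stdGaussian (Space d)) ≤
      ENNReal.ofReal (((1 - γ₁ + γ₂ * (K / Real.sqrt d)) * ‖x j - best f x‖) ^ d) *
        stdGaussian (Space d)
          {e | ‖e‖ ≤ K ∧ isoMap γ₁ γ₂ (x j) (best f x) e ∈ improveSet f S x j} +
      ENNReal.ofReal (‖x j - best f x‖ ^ d) *
        ∫⁻ e in {e | K < ‖e‖}, ENNReal.ofReal (factor d γ₁ γ₂ e ^ d) ∂(stdGaussian (Space d)) := by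
  have hm1 : MeasurableSet {e : Space d | K < ‖e‖} :=
    measurableSet_lt measurable_const measurable_norm
  have hm2 : MeasurableSet
      {e | ‖e‖ ≤ K ∧ isoMap γ₁ γ₂ (x j) (best f x) e ∈ improveSet f S x j} :=
    (measurableSet_le measurable_norm measurable_const).inter
      ((continuous_isoMap (γ₁ := γ₁) (γ₂ := γ₂) (x j) (best f x)).measurable
        (measurableSet_improveSet_fixed (x := x) hcl hf j))
  have hfm : Measurable fun e : Space d => ENNReal.ofReal (factor d γ₁ γ₂ e ^ d) :=
    (((continuous_factor d γ₁ γ₂).pow d).measurable).ennreal_ofReal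
  have hpt : ∀ e, moveFun f S γ₁ γ₂ R x j e ≤
      {e | ‖e‖ ≤ K ∧ isoMap γ₁ γ₂ (x j) (best f x) e ∈ improveSet f S x j}.indicator
        (fun _ => ENNReal.ofReal (((1 - γ₁ + γ₂ * (K / Real.sqrt d)) * ‖x j - best f x‖) ^ d)) e +
      {e : Space d | K < ‖e‖}.indicator (fun e => ENNReal.ofReal (‖x j - best f x‖ ^ d) *
        ENNReal.ofReal (factor d γ₁ γ₂ e ^ d)) e := by
    intro e
    have hφ := factor_nonneg h1 h2 e
    have hφD : 0 ≤ factor d γ₁ γ₂ e * ‖x j - best f x‖ := mul_nonneg hφ (norm_nonneg _)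
    have hle : moveFun f S γ₁ γ₂ R x j e ≤
        ENNReal.ofReal ((factor d γ₁ γ₂ e * ‖x j - best f x‖) ^ d) :=
      (moveFun_le hR h1 h2 j e).trans (ENNReal.ofReal_le_ofReal
        (pow_le_pow_left₀ (le_min (by linarith) hφD) (min_le_right _ _) d))
    by_cases he : K < ‖e‖
    · refine le_trans ?_ le_add_self
      rw [Set.indicator_of_mem (by exact he), ← ENNReal.ofReal_mul (pow_nonneg (norm_nonneg _) d),
        mul_comm, ← mul_pow]
      exact hle
    · refine le_trans ?_ le_self_add
      by_cases hU : isoMap γ₁ γ₂ (x j) (best f x) e ∈ improveSet f S x j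
      · rw [Set.indicator_of_mem (by exact ⟨not_lt.1 he, hU⟩)]
        refine hle.trans (ENNReal.ofReal_le_ofReal (pow_le_pow_left₀ hφD ?_ d))
        refine mul_le_mul_of_nonneg_right ?_ (norm_nonneg _)
        unfold factor
        gcongr
        exact not_lt.1 he
      · rw [moveFun, Set.indicator_of_notMem (by exact hU)]
        exact zero_le
  refine (lintegral_mono hpt).trans (le_of_eq ?_)
  rw [lintegral_add_left (measurable_const.indicator hm2), lintegral_indicator hm1,
    lintegral_indicator hm2, setLIntegral_const, lintegral_const_mul _ hfm]

/-- The expected displacement caused by one agent is dominated by a small multiple of its distance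
to the consensus point and the expected loss of improving volume. -/
theorem exists_lintegral_moveFun_add_le (hd : d ≠ 0) (hcl : IsClosed S) (hf : Measurable f)
    (h1 : γ₁ < 1) (h2 : 0 < γ₂) (hγ : (1 - γ₁ + γ₂) ^ 2 ≤ 1 / 2) {R : ℝ} (hR : 0 ≤ R)
    {ε : ℝ} (hε : 0 < ε) :
    ∃ ρ H : ℝ, 0 ≤ H ∧ ∀ x : Fin N → Space d, best f x ∈ S →
      best f x ∈ Metric.closedBall 0 R →
      ∀ (κ : Measure (Fin N → Space d)) [IsProbabilityMeasure κ] (j : Fin N),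
      κ.map (fun e => e j) = stdGaussian (Space d) →
      ∫⁻ e, moveFun f S γ₁ γ₂ R x j e ∂(stdGaussian (Space d)) +
        ENNReal.ofReal H * ∫⁻ e, improveVol f S ρ (step f S γ₁ γ₂ x e) ∂κ
        ≤ ENNReal.ofReal (ε * ‖x j - best f x‖ ^ d) + ENNReal.ofReal H * improveVol f S ρ x := by
  have hmom : ∫⁻ e, ENNReal.ofReal (factor d γ₁ γ₂ e ^ d) ∂(stdGaussian (Space d)) ≠ ∞ :=
    ((lintegral_factor_pow_le hd h1.le h2.le hγ).trans_lt ENNReal.ofReal_lt_top).ne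
  obtain ⟨K, hK, hKtail⟩ := exists_lintegral_norm_gt_le hmom (half_pos hε)
  set k := 1 - γ₁ + γ₂ * (K / Real.sqrt d) with hk
  have hk0 : 0 < k := by
    have : 0 < 1 - γ₁ := by linarith
    positivity
  obtain ⟨C, hC, hCle⟩ := exists_measure_isoMap_le hd h1.le h2 K
  obtain ⟨c, hc, hcle⟩ :=
    exists_improveVol_drop (N := N) (f := f) (S := S) hd hcl hf h1.le h2 k
  -- Beyond distance `M` the truncated jump `2 * R` is less than `min ε 1 * D`, so no volume has to
  -- be spent.
  set M := 2 * R / min ε 1 with hM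
  have hε' : 0 < min ε 1 := lt_min hε one_pos
  set B := k ^ d * C with hB
  have hB0 : 0 < B := by positivity
  -- Chosen so that `B * r = ε / 2`; the other half of `ε` pays for the tail.
  set r := ε / 2 / B with hr
  have hr0 : 0 < r := by positivity
  -- The radius `R + k * M` contains the ball of radius `k * D` about the best point whenever `D ≤
  -- M`. The weight `B / r / c` turns the drop `c * v^2 / D^d` into `B * v^2 / (r * D^d)`.
  refine ⟨R + k * M, B / r / c, by positivity, fun x hp hpR κ _ j hκ => ?_⟩
  have hweak := lintegral_improveVol_step_le (γ₁ := γ₁) (γ₂ := γ₂) hcl hf hp (R + k * M) κ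
  set p := best f x with hpdef
  set D := ‖x j - p‖ with hD
  by_cases hfar : M < D
  · refine add_le_add ?_ (mul_le_mul_right hweak _)
    calc ∫⁻ e, moveFun f S γ₁ γ₂ R x j e ∂(stdGaussian (Space d))
        ≤ ∫⁻ _, ENNReal.ofReal (ε * D ^ d) ∂(stdGaussian (Space d)) := by
          refine lintegral_mono fun e =>
            (moveFun_le hR h1.le h2.le j e).trans (ENNReal.ofReal_le_ofReal ?_)
          have := factor_nonneg h1.le h2.le e
          calc _ ≤ (2 * R) ^ d := pow_le_pow_left₀ (by positivity) (min_le_left _ _) d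
            _ ≤ (min ε 1 * D) ^ d := by
              refine pow_le_pow_left₀ (by positivity) ?_ d
              rw [hM, div_lt_iff₀ hε'] at hfar
              linarith
            _ = min ε 1 ^ d * D ^ d := mul_pow _ _ _
            _ ≤ ε * D ^ d := by
              refine mul_le_mul_of_nonneg_right ?_ (by positivity)
              exact (pow_le_of_le_one hε'.le (min_le_right _ _) hd).trans (min_le_left _ _)
      _ = _ := by simp
  by_cases hx : x j = p
  · refine add_le_add ?_ (mul_le_mul_right hweak _)
    have : D = 0 := by rw [hD, hx, sub_self, norm_zero]
    refine (lintegral_mono fun e => moveFun_le hR h1.le h2.le j e).trans ?_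
    rw [← hpdef, ← hD, this]
    simp [hd, hR]
  have hD0 : 0 < D := norm_pos_iff.2 (sub_ne_zero.2 hx)
  have hdrop := hcle (R + k * M) x hp κ j hκ hx (by
    refine Metric.closedBall_subset_closedBall' ?_
    rw [mem_closedBall_zero_iff] at hpR
    rw [dist_zero_right]
    have := mul_le_mul_of_nonneg_left (not_lt.1 hfar) hk0.le
    linarith)
  have hmove := lintegral_moveFun_le (S := S) (x := x) hcl hf hR h1.le h2.le j K
  have hCU := hCle (x j) p hx _ (measurableSet_improveSet_fixed (x := x) hcl hf j)
  rw [← hpdef, ← hD, ← hk] at hmove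
  rw [← hD, ← hk] at hCU
  set Q := improveSet f S x j ∩ Metric.closedBall p (k * D) with hQ
  have hQfin : volume Q ≠ ∞ :=
    ((measure_mono Set.inter_subset_right).trans_lt measure_closedBall_lt_top).ne
  set v := (volume Q).toReal with hv
  have hv0 : 0 ≤ v := ENNReal.toReal_nonneg
  have hQv : volume Q = ENNReal.ofReal v := (ENNReal.ofReal_toReal hQfin).symm
  rw [hQv] at hdrop hCU
  have hmain : ∫⁻ e, moveFun f S γ₁ γ₂ R x j e ∂(stdGaussian (Space d)) ≤
      ENNReal.ofReal (ε * D ^ d) +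
        ENNReal.ofReal (B / r / c) * (ENNReal.ofReal (c / D ^ d) * ENNReal.ofReal v ^ 2) := by
    refine (hmove.trans (add_le_add (mul_le_mul_right hCU _) (mul_le_mul_right hKtail _))).trans ?_
    rw [← ENNReal.ofReal_pow hv0, ← ENNReal.ofReal_mul (by positivity),
      ← ENNReal.ofReal_mul (by positivity), ← ENNReal.ofReal_mul (by positivity),
      ← ENNReal.ofReal_mul (by positivity), ← ENNReal.ofReal_mul (by positivity),
      ← ENNReal.ofReal_add (by positivity) (by positivity),
      ← ENNReal.ofReal_add (by positivity) (by positivity)]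
    refine ENNReal.ofReal_le_ofReal ?_
    have e1 : (k * D) ^ d * (C / D ^ d * v) = B * v := by
      rw [mul_pow, hB]; field_simp
    have e2 : B / r / c * (c / D ^ d * v ^ 2) = B * (v ^ 2 / (r * D ^ d)) := by
      field_simp
    have e3 : ε / 2 = B * r := by rw [hr]; field_simp
    -- Weighted Young inequality `v ≤ w + v^2 / w`: it trades the linear jump bound for the
    -- quadratic loss of volume.
    have e4 : v ≤ r * D ^ d + v ^ 2 / (r * D ^ d) := by
      have hw : 0 < r * D ^ d := by positivity
      set w := r * D ^ d
      have : v * w ≤ w * w + v ^ 2 := by nlinarith [sq_nonneg (v - w), mul_nonneg hv0 hw.le]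
      calc v = v * w / w := by field_simp
        _ ≤ (w * w + v ^ 2) / w := by gcongr
        _ = _ := by field_simp
    rw [e1, e2]
    have e5 := mul_le_mul_of_nonneg_left e4 hB0.le
    have e6 : ε * D ^ d = B * r * D ^ d + ε / 2 * D ^ d := by rw [← e3]; ring
    rw [e6]
    linarith
  calc _ ≤ (ENNReal.ofReal (ε * D ^ d) +
        ENNReal.ofReal (B / r / c) * (ENNReal.ofReal (c / D ^ d) * ENNReal.ofReal v ^ 2)) +
        ENNReal.ofReal (B / r / c) *
          ∫⁻ e, improveVol f S (R + k * M) (step f S γ₁ γ₂ x e) ∂κ := add_le_add hmain le_rfl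
    _ = ENNReal.ofReal (ε * D ^ d) + ENNReal.ofReal (B / r / c) *
        (∫⁻ e, improveVol f S (R + k * M) (step f S γ₁ γ₂ x e) ∂κ +
          ENNReal.ofReal (c / D ^ d) * ENNReal.ofReal v ^ 2) := by ring
    _ ≤ _ := add_le_add le_rfl (mul_le_mul_right hdrop _)

/-- The spread of a configuration around its best agent. -/
noncomputable def spread (f : Space d → EReal) (x : Fin N → Space d) : ℝ≥0∞ :=
  ∑ i, ENNReal.ofReal (‖x i - best f x‖ ^ d)

theorem measurable_spread (hf : Measurable f) : Measurable (spread (N := N) f) := by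
  refine Finset.measurable_sum _ fun i _ => ?_
  exact (((measurable_pi_apply i).sub (measurable_best hf)).norm.pow_const d).ennreal_ofReal

/-- Configurations whose sublevel set is contained in `S` and in the ball of radius `R`. -/
def Good (f : Space d → EReal) (S : Set (Space d)) (R : ℝ) (x : Fin N → Space d) : Prop :=
  best f x ∈ S ∧ {y | f y ≤ f (best f x)} ⊆ Metric.closedBall 0 R

theorem Good.step {R : ℝ} (hdom : ∀ x, f x < ⊤ ↔ x ∈ S) (h : Good f S R x)
    (e : Fin N → Space d) : Good f S R (step f S γ₁ γ₂ x e) := by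
  have hle := best_step_le (γ₁ := γ₁) (γ₂ := γ₂) h.1 e
  exact ⟨(hdom _).1 (hle.trans_lt ((hdom _).2 h.1)),
    fun y hy => h.2 (le_trans (show f y ≤ _ from hy) hle)⟩

/-- Either the best point stays, and `0^d = 0`, or it moves to an accepted proposal, which the
correction does not push away from the old best point. Both best points lie in the ball of radius
`R`, which justifies the truncation at `2 * R`. -/
theorem norm_best_step_sub_pow_le (hd : d ≠ 0) (hcl : IsClosed S) {R : ℝ} (h : Good f S R x)
    (e : Fin N → Space d) :
    ENNReal.ofReal (‖best f (step f S γ₁ γ₂ x e) - best f x‖ ^ d)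
      ≤ ∑ j, moveFun f S γ₁ γ₂ R x j (e j) := by
  rcases best_step_eq_or h.1 e (γ₁ := γ₁) (γ₂ := γ₂) with h0 | ⟨j, hj, hbest⟩
  · simp [h0, hd]
  · refine le_trans ?_ (Finset.single_le_sum (fun _ _ => zero_le) (Finset.mem_univ j))
    rw [moveFun, Set.indicator_of_mem (show e j ∈ _ from hj)]
    refine ENNReal.ofReal_le_ofReal (pow_le_pow_left₀ (norm_nonneg _) (le_min ?_ ?_) d)
    · have h1 : best f (DCBO.step f S γ₁ γ₂ x e) ∈ Metric.closedBall 0 R :=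
        h.2 (best_step_le h.1 e)
      have h2 : best f x ∈ Metric.closedBall 0 R := h.2 (le_refl (f (best f x)))
      rw [mem_closedBall_zero_iff] at h1 h2
      linarith [norm_sub_le (best f (DCBO.step f S γ₁ γ₂ x e)) (best f x)]
    · rw [hbest]
      exact norm_correct_sub_le_of_mem hcl h.1 _

/-- The triangle inequality through the old best point separates the contraction of the distances
from the motion of the best point. -/
theorem spread_step_le (hd : d ≠ 0) (hcl : IsClosed S) (h1 : γ₁ ≤ 1) (h2 : 0 ≤ γ₂) {R : ℝ}
    (h : Good f S R x) {δ : ℝ} (hδ : 0 < δ) (e : Fin N → Space d) :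
    spread f (step f S γ₁ γ₂ x e) ≤
      ∑ i, ENNReal.ofReal ((1 + δ) ^ d * ‖x i - best f x‖ ^ d) *
          ENNReal.ofReal (factor d γ₁ γ₂ (e i) ^ d) +
        N * ENNReal.ofReal ((1 + 1 / δ) ^ d) * ∑ j, moveFun f S γ₁ γ₂ R x j (e j) := by
  have hi : ∀ i, ENNReal.ofReal
      (‖step f S γ₁ γ₂ x e i - best f (step f S γ₁ γ₂ x e)‖ ^ d) ≤
      ENNReal.ofReal ((1 + δ) ^ d * ‖x i - best f x‖ ^ d) *
          ENNReal.ofReal (factor d γ₁ γ₂ (e i) ^ d) +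
        ENNReal.ofReal ((1 + 1 / δ) ^ d) * ∑ j, moveFun f S γ₁ γ₂ R x j (e j) := by
    intro i
    set x' := step f S γ₁ γ₂ x e
    have hφ := factor_nonneg h1 h2 (e i)
    have h3 : ‖x' i - best f x'‖ ^ d ≤ (1 + δ) ^ d * ‖x i - best f x‖ ^ d *
        factor d γ₁ γ₂ (e i) ^ d + (1 + 1 / δ) ^ d * ‖best f x' - best f x‖ ^ d := by
      calc ‖x' i - best f x'‖ ^ d ≤ (‖x' i - best f x‖ + ‖best f x' - best f x‖) ^ d := by
            refine pow_le_pow_left₀ (norm_nonneg _) ?_ d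
            rw [norm_sub_rev (best f x')]
            exact norm_sub_le_norm_sub_add_norm_sub _ _ _
        _ ≤ (1 + δ) ^ d * ‖x' i - best f x‖ ^ d +
            (1 + 1 / δ) ^ d * ‖best f x' - best f x‖ ^ d :=
            add_pow_le_mul_add_mul (norm_nonneg _) (norm_nonneg _) hδ d
        _ ≤ _ := by
            rw [mul_assoc, ← mul_pow ‖x i - best f x‖]
            gcongr
            rw [mul_comm]
            exact norm_step_sub_le hcl h1 h2 h.1 e i
    refine (ENNReal.ofReal_le_ofReal h3).trans ?_
    rw [ENNReal.ofReal_add (by positivity) (by positivity), ENNReal.ofReal_mul (by positivity),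
      ENNReal.ofReal_mul (by positivity : (0:ℝ) ≤ (1 + 1 / δ) ^ d)]
    exact add_le_add le_rfl (mul_le_mul_right (norm_best_step_sub_pow_le hd hcl h e) _)
  refine (Finset.sum_le_sum fun i _ => hi i).trans (le_of_eq ?_)
  rw [Finset.sum_add_distrib, Finset.sum_const, Finset.card_univ, Fintype.card_fin, nsmul_eq_mul,
    mul_assoc]

theorem lintegral_spread_step_le (hd : d ≠ 0) (hcl : IsClosed S) (hf : Measurable f)
    (h1 : γ₁ ≤ 1) (h2 : 0 ≤ γ₂) (hγ : (1 - γ₁ + γ₂) ^ 2 ≤ 1 / 2) {R : ℝ}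
    (h : Good f S R x) {δ : ℝ} (hδ : 0 < δ) (κ : Measure (Fin N → Space d))
    (hκ : ∀ j, κ.map (fun e => e j) = stdGaussian (Space d)) :
    ∫⁻ e, spread f (step f S γ₁ γ₂ x e) ∂κ ≤
      ENNReal.ofReal (((1 + δ) * Real.sqrt (5 / 6)) ^ d) * spread f x +
        N * ENNReal.ofReal ((1 + 1 / δ) ^ d) *
          ∑ j, ∫⁻ e, moveFun f S γ₁ γ₂ R x j e ∂(stdGaussian (Space d)) := by
  have hmarg : ∀ (j : Fin N) {g : Space d → ℝ≥0∞}, Measurable g →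
      ∫⁻ e, g (e j) ∂κ = ∫⁻ e, g e ∂(stdGaussian (Space d)) := by
    intro j g hg
    rw [← hκ j]
    exact (lintegral_map hg (measurable_pi_apply j)).symm
  have hmm := fun j => measurable_moveFun (γ₁ := γ₁) (γ₂ := γ₂) (x := x) hcl hf R j
  have hfm : Measurable fun e : Space d => ENNReal.ofReal (factor d γ₁ γ₂ e ^ d) :=
    (((continuous_factor d γ₁ γ₂).pow d).measurable).ennreal_ofReal
  have hfm' : ∀ i, Measurable fun e : Fin N → Space d =>
      ENNReal.ofReal (factor d γ₁ γ₂ (e i) ^ d) := fun i => hfm.comp (measurable_pi_apply i)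
  have hmm' : ∀ j, Measurable fun e : Fin N → Space d => moveFun f S γ₁ γ₂ R x j (e j) :=
    fun j => (hmm j).comp (measurable_pi_apply j)
  refine (lintegral_mono fun e => spread_step_le hd hcl h1 h2 h hδ e).trans ?_
  rw [lintegral_add_left (Finset.measurable_sum _ fun i _ => (hfm' i).const_mul _),
    lintegral_const_mul _ (Finset.measurable_sum _ fun j _ => hmm' j),
    lintegral_finsetSum _ (fun i _ => (hfm' i).const_mul _),
    lintegral_finsetSum _ (fun j _ => hmm' j)]
  refine add_le_add ?_ (le_of_eq ?_)
  · rw [spread, Finset.mul_sum]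
    refine Finset.sum_le_sum fun i _ => ?_
    rw [lintegral_const_mul _ (hfm' i), hmarg i hfm]
    refine (mul_le_mul_right (lintegral_factor_pow_le hd h1 h2 hγ) _).trans (le_of_eq ?_)
    rw [← ENNReal.ofReal_mul (by positivity), ← ENNReal.ofReal_mul (by positivity), mul_pow]
    congr 1
    ring
  · congr 1
    exact Finset.sum_congr rfl fun j _ => hmarg j (hmm j)

/-- The Lyapunov inequality. -/
theorem exists_lyapunov (hd : d ≠ 0) (hcl : IsClosed S) (hf : Measurable f)
    (h1 : γ₁ < 1) (h2 : 0 < γ₂) (hγ : (1 - γ₁ + γ₂) ^ 2 ≤ 1 / 2) {R : ℝ} (hR : 0 ≤ R) :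
    ∃ ρ H c : ℝ, 0 < c ∧ ∀ x : Fin N → Space d, Good f S R x →
      ∀ (κ : Measure (Fin N → Space d)) [IsProbabilityMeasure κ],
      (∀ j, κ.map (fun e => e j) = stdGaussian (Space d)) →
      ∫⁻ e, spread f (step f S γ₁ γ₂ x e) +
          ENNReal.ofReal H * improveVol f S ρ (step f S γ₁ γ₂ x e) ∂κ
        + ENNReal.ofReal c * spread f x
        ≤ spread f x + ENNReal.ofReal H * improveVol f S ρ x := by
  have hN : (0 : ℝ) < N := by exact_mod_cast Nat.pos_of_ne_zero (NeZero.ne N)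
  -- Small enough that `(1 + δ) * √(5/6) < 1`, since `√(5/6) < 20/21`.
  set δ : ℝ := 1 / 20 with hδ
  have hδ0 : 0 < δ := by norm_num
  set A : ℝ := ((1 + δ) * Real.sqrt (5 / 6)) ^ d with hA
  have hA0 : 0 ≤ A := by positivity
  have hA1 : A < 1 := by
    refine pow_lt_one₀ (by positivity) ?_ hd
    have h3 : Real.sqrt (5 / 6) < 20 / 21 := by
      rw [Real.sqrt_lt' (by norm_num)]
      norm_num
    rw [hδ]
    linarith
  set L : ℝ := (1 + 1 / δ) ^ d with hL
  have hL0 : 0 < L := by positivity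
  -- Chosen so that `N * L * ε = (1 - A) / 2`: the contraction `A`, the jump error and the gain `c =
  -- (1 - A) / 2` add up to exactly one.
  set ε : ℝ := (1 - A) / 2 / (N * L) with hε
  have hε0 : 0 < ε := div_pos (by linarith) (by positivity)
  obtain ⟨ρ, H, hH, hle⟩ :=
    exists_lintegral_moveFun_add_le (N := N) (f := f) (S := S) hd hcl hf h1 h2 hγ hR hε0
  refine ⟨ρ, N * L * (N * H), (1 - A) / 2, by linarith, fun x hx κ _ hκ => ?_⟩
  have hpR : best f x ∈ Metric.closedBall 0 R := hx.2 (le_refl (f (best f x)))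
  set V' := ∫⁻ e, improveVol f S ρ (step f S γ₁ γ₂ x e) ∂κ with hV'
  have hstepm : Measurable fun e : Fin N → Space d => step f S γ₁ γ₂ x e :=
    measurable_pi_lambda _ fun i => (measurable_correct hcl).comp
      ((continuous_isoMap _ _).measurable.comp (measurable_pi_apply i))
  have hsum : ∑ j, ∫⁻ e, moveFun f S γ₁ γ₂ R x j e ∂(stdGaussian (Space d)) +
      N * (ENNReal.ofReal H * V') ≤
      ENNReal.ofReal ε * spread f x + N * (ENNReal.ofReal H * improveVol f S ρ x) := by
    have := Finset.sum_le_sum fun j (_ : j ∈ Finset.univ) => hle x hx.1 hpR κ j (hκ j)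
    simp only [Finset.sum_add_distrib, Finset.sum_const, Finset.card_univ, Fintype.card_fin,
      nsmul_eq_mul, ENNReal.ofReal_mul hε0.le, ← Finset.mul_sum] at this
    exact this
  have hNL : (N : ℝ≥0∞) * ENNReal.ofReal L = ENNReal.ofReal (N * L) := by
    rw [ENNReal.ofReal_mul hN.le, ENNReal.ofReal_natCast]
  have hHH : ENNReal.ofReal (N * L * (N * H)) =
      ENNReal.ofReal (N * L) * (N * ENNReal.ofReal H) := by
    rw [ENNReal.ofReal_mul (by positivity), ENNReal.ofReal_mul (p := (N : ℝ)) (q := H) hN.le,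
      ENNReal.ofReal_natCast]
  have hVm : Measurable fun e => improveVol f S ρ (step f S γ₁ γ₂ x e) :=
    (measurable_improveVol hcl hf ρ).comp hstepm
  have hspread := lintegral_spread_step_le hd hcl hf h1.le h2.le hγ hx hδ0 κ hκ
  rw [← hA, ← hL, hNL] at hspread
  rw [lintegral_add_right _ (hVm.const_mul _),
    lintegral_const_mul _ hVm, ← hV', hHH]
  calc _ ≤ (ENNReal.ofReal A * spread f x + ENNReal.ofReal (N * L) *
          ∑ j, ∫⁻ e, moveFun f S γ₁ γ₂ R x j e ∂(stdGaussian (Space d))) +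
        ENNReal.ofReal (N * L) * (N * ENNReal.ofReal H) * V' +
        ENNReal.ofReal ((1 - A) / 2) * spread f x := by gcongr
    _ = ENNReal.ofReal A * spread f x + ENNReal.ofReal (N * L) *
          (∑ j, ∫⁻ e, moveFun f S γ₁ γ₂ R x j e ∂(stdGaussian (Space d)) +
            N * (ENNReal.ofReal H * V')) + ENNReal.ofReal ((1 - A) / 2) * spread f x := by ring
    _ ≤ ENNReal.ofReal A * spread f x + ENNReal.ofReal (N * L) *
          (ENNReal.ofReal ε * spread f x + N * (ENNReal.ofReal H * improveVol f S ρ x)) +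
          ENNReal.ofReal ((1 - A) / 2) * spread f x := by gcongr
    _ = (ENNReal.ofReal A + ENNReal.ofReal (N * L) * ENNReal.ofReal ε +
          ENNReal.ofReal ((1 - A) / 2)) * spread f x +
          ENNReal.ofReal (N * L) * (N * ENNReal.ofReal H) * improveVol f S ρ x := by ring
    _ = _ := by
      have : ENNReal.ofReal A + ENNReal.ofReal (N * L) * ENNReal.ofReal ε +
          ENNReal.ofReal ((1 - A) / 2) = 1 := by
        rw [← ENNReal.ofReal_mul (by positivity), ← ENNReal.ofReal_add hA0 (by positivity),
          ← ENNReal.ofReal_add (by positivity) (by linarith), ← ENNReal.ofReal_one]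
        congr 1
        rw [hε]
        field_simp
        ring
      rw [this, one_mul]

end OneStep

/-! ### Regrouping independent variables. -/

/-- This passes from independence of the initial positions and the whole noise to independence of
the past and the present noise; the laws are compared on measurable boxes. -/
theorem indepFun_prodMk_of_indepFun_prodMk {Ω α β γ : Type*} [MeasurableSpace Ω]
    [MeasurableSpace α] [MeasurableSpace β] [MeasurableSpace γ] {P : Measure Ω}
    [IsProbabilityMeasure P] {A : Ω → α} {B : Ω → β} {C : Ω → γ} (hA : Measurable A)
    (hB : Measurable B) (hC : Measurable C) (hABC : IndepFun A (fun ω => (B ω, C ω)) P)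
    (hBC : IndepFun B C P) : IndepFun (fun ω => (A ω, B ω)) C P := by
  have hAB : IndepFun A B P := hABC.comp measurable_id measurable_fst
  rw [indepFun_iff_map_prod_eq_prod_map_map (hA.prodMk hB).aemeasurable hC.aemeasurable]
  have : IsFiniteMeasure (P.map fun ω => ((A ω, B ω), C ω)) :=
    Measure.isFiniteMeasure_map _ _
  refine Measure.ext_prod₃' fun {s t u} hs ht hu => ?_
  rw [Measure.map_apply ((hA.prodMk hB).prodMk hC) ((hs.prod ht).prod hu), Measure.prod_prod,
    Measure.map_apply (hA.prodMk hB) (hs.prod ht), Measure.map_apply hC hu]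
  have h1 := hABC.measure_inter_preimage_eq_mul _ _ hs (ht.prod hu)
  have h2 := hBC.measure_inter_preimage_eq_mul _ _ ht hu
  have h3 := hAB.measure_inter_preimage_eq_mul _ _ hs ht
  have e1 : (fun ω => ((A ω, B ω), C ω)) ⁻¹' ((s ×ˢ t) ×ˢ u)
      = A ⁻¹' s ∩ (fun ω => (B ω, C ω)) ⁻¹' (t ×ˢ u) := by
    ext ω; simp [and_assoc]
  have e2 : (fun ω => (B ω, C ω)) ⁻¹' (t ×ˢ u) = B ⁻¹' t ∩ C ⁻¹' u := rfl
  have e3 : (fun ω => (A ω, B ω)) ⁻¹' (s ×ˢ t) = A ⁻¹' s ∩ B ⁻¹' t := rfl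
  rw [e1, h1, e2, h2, e3, h3, mul_assoc]

/-! ### The iterates: adaptedness, invariants and criteria for consensus. -/

section Iterates

variable {d N : ℕ} [NeZero N] {f : Space d → EReal} {S : Set (Space d)} {γ₁ γ₂ : ℝ}

theorem iterates_succ (x0 : Fin N → Space d) (η : ℕ → Fin N → Space d) (n : ℕ) :
    iterates f S γ₁ γ₂ x0 η (n + 1) = step f S γ₁ γ₂ (iterates f S γ₁ γ₂ x0 η n) (η n) := rfl

theorem iterates_congr (x0 : Fin N → Space d) {η η' : ℕ → Fin N → Space d} {n : ℕ}
    (h : ∀ k < n, η k = η' k) :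
    iterates f S γ₁ γ₂ x0 η n = iterates f S γ₁ γ₂ x0 η' n := by
  induction n with
  | zero => rfl
  | succ n ih =>
    rw [iterates_succ, iterates_succ, ih fun k hk => h k (hk.trans n.lt_succ_self),
      h n n.lt_succ_self]

theorem measurable_step (hcl : IsClosed S) (hf : Measurable f) :
    Measurable fun q : (Fin N → Space d) × (Fin N → Space d) => step f S γ₁ γ₂ q.1 q.2 := by
  have hb : Measurable fun q : (Fin N → Space d) × (Fin N → Space d) => best f q.1 :=
    (measurable_best hf).comp measurable_fst
  refine measurable_pi_lambda _ fun i => (measurable_correct hcl).comp ?_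
  unfold isoMap
  fun_prop

theorem measurable_iterates (hcl : IsClosed S) (hf : Measurable f) (n : ℕ) :
    Measurable fun q : (Fin N → Space d) × (ℕ → Fin N → Space d) =>
      iterates f S γ₁ γ₂ q.1 q.2 n := by
  induction n with
  | zero => exact measurable_fst
  | succ n ih =>
    have hη : Measurable fun q : (Fin N → Space d) × (ℕ → Fin N → Space d) => q.2 n := by fun_prop
    have h := (measurable_step (N := N) (γ₁ := γ₁) (γ₂ := γ₂) hcl hf).comp (ih.prodMk hη)
    exact h

theorem good_iterates {R : ℝ} (hdom : ∀ x, f x < ⊤ ↔ x ∈ S) {x0 : Fin N → Space d}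
    (h : Good f S R x0) (η : ℕ → Fin N → Space d) (n : ℕ) :
    Good f S R (iterates f S γ₁ γ₂ x0 η n) := by
  induction n with
  | zero => exact h
  | succ n ih => exact ih.step hdom _

theorem best_iterates_antitone (hdom : ∀ x, f x < ⊤ ↔ x ∈ S) {x0 : Fin N → Space d}
    (h : best f x0 ∈ S) (η : ℕ → Fin N → Space d) :
    Antitone fun n => f (best f (iterates f S γ₁ γ₂ x0 η n)) := by
  have hmem : ∀ n, best f (iterates f S γ₁ γ₂ x0 η n) ∈ S := by
    intro n
    induction n with
    | zero => exact h
    | succ n ih => exact (hdom _).1 ((best_step_le ih _).trans_lt ((hdom _).2 ih))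
  exact antitone_nat_of_succ_le fun n => best_step_le (hmem n) _

theorem measurableSet_good (hcl : IsClosed S) (hf : Measurable f) (R : ℝ) :
    MeasurableSet {x : Fin N → Space d | Good f S R x} := by
  -- Containment of the sublevel set in the ball is a downward closed condition on the level, hence
  -- defines a Borel set of levels.
  have h1 : Set.OrdConnected {c : EReal | {y | f y ≤ c} ⊆ Metric.closedBall 0 R} :=
    ⟨fun a _ b hb c hc y hy => hb (le_trans (show f y ≤ c from hy) hc.2)⟩
  exact (measurable_best hf hcl.measurableSet).inter
    ((hf.comp (measurable_best hf)) h1.measurableSet)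

/-- Vanishing spread means consensus. -/
theorem consensus_of_tendsto_spread {X : ℕ → Fin N → Space d}
    (h : Tendsto (fun n => spread f (X n)) atTop (𝓝 0)) : Consensus X := by
  have h1 : ∀ i, Tendsto (fun n => ‖X n i - best f (X n)‖) atTop (𝓝 0) := by
    intro i
    rw [Metric.tendsto_atTop]
    intro ε hε
    obtain ⟨n0, hn0⟩ := eventually_atTop.1
      (h.eventually_lt_const (ENNReal.ofReal_pos.2 (pow_pos hε d)))
    refine ⟨n0, fun n hn => ?_⟩
    have h2 : ENNReal.ofReal (‖X n i - best f (X n)‖ ^ d) < ENNReal.ofReal (ε ^ d) :=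
      (Finset.single_le_sum (f := fun i => ENNReal.ofReal (‖X n i - best f (X n)‖ ^ d))
        (fun _ _ => zero_le) (Finset.mem_univ i)).trans_lt (hn0 n hn)
    rw [Real.dist_eq, sub_zero, abs_of_nonneg (norm_nonneg _)]
    exact lt_of_pow_lt_pow_left₀ d hε.le ((ENNReal.ofReal_lt_ofReal_iff (pow_pos hε d)).1 h2)
  intro i j
  refine squeeze_zero (fun n => norm_nonneg _) (fun n => ?_) (by simpa using (h1 i).add (h1 j))
  rw [norm_sub_rev (X n j)]
  exact norm_sub_le_norm_sub_add_norm_sub _ _ _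

/-- Without noise the mutual distances contract. -/
theorem consensus_of_noiseless (hcl : IsClosed S) (hγ₁ : γ₁ ∈ Set.Ioo (0 : ℝ) 1)
    (x0 : Fin N → Space d) (η : ℕ → Fin N → Space d) :
    Consensus (iterates f S γ₁ 0 x0 η) := by
  intro i j
  have h0 : 0 ≤ 1 - γ₁ := by linarith [hγ₁.2]
  have hle : ∀ n, ‖iterates f S γ₁ 0 x0 η n i - iterates f S γ₁ 0 x0 η n j‖
      ≤ (1 - γ₁) ^ n * ‖x0 i - x0 j‖ := by
    intro n
    induction n with
    | zero => simp [iterates]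
    | succ n ih =>
      refine (norm_correct_sub_le hcl _ _).trans ?_
      have : ∀ a b p e e' : Space d, isoMap γ₁ 0 a p e - isoMap γ₁ 0 b p e'
          = (1 - γ₁) • (a - b) := by
        intro a b p e e'
        simp only [isoMap, zero_mul, zero_smul, add_zero]
        module
      rw [this, norm_smul, Real.norm_of_nonneg h0, pow_succ', mul_assoc]
      exact mul_le_mul_of_nonneg_left ih h0
  refine squeeze_zero (fun n => norm_nonneg _) hle ?_
  simpa using (tendsto_pow_atTop_nhds_zero_of_lt_one h0 (by linarith [hγ₁.1])).mul_const
    ‖x0 i - x0 j‖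

end Iterates

/-! ### Summation of the Lyapunov inequality along random paths. -/

section Random

variable {d N : ℕ} [NeZero N] {f : Space d → EReal} {S : Set (Space d)} {γ₁ γ₂ : ℝ}
  {Ω : Type*} [MeasurableSpace Ω] {P : Measure Ω} [IsProbabilityMeasure P]
  {x0 : Ω → Fin N → Space d} {η : ℕ → Fin N → Ω → Space d}

/-- The configuration at time `n` is a function of the initial positions and the noises before `n`.
The initial positions are kept in the pair because the event to which the estimates are restricted
depends on them. -/
theorem indepFun_iterates_noise (hcl : IsClosed S) (hf : Measurable f)
    (hin : IsInput P S x0 η) (n : ℕ) :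
    IndepFun (fun ω => (x0 ω, iterates f S γ₁ γ₂ (x0 ω) (fun k i => η k i ω) n))
      (fun ω i => η n i ω) P := by
  classical
  set A : Finset (ℕ × Fin N) := Finset.range n ×ˢ Finset.univ with hA
  set B : Finset (ℕ × Fin N) := {n} ×ˢ Finset.univ with hB
  have hdisj : Disjoint A B := by
    rw [Finset.disjoint_left]
    rintro ⟨k, i⟩ h1 h2
    simp only [hA, hB, Finset.mem_product, Finset.mem_range, Finset.mem_singleton,
      Finset.mem_univ, and_true] at h1 h2
    omega
  have hnoise : ∀ q : ℕ × Fin N, Measurable fun ω => η q.1 q.2 ω :=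
    fun q => hin.measurable_noise q.1 q.2
  have hpp := hin.noise_indep.indepFun_finset A B hdisj hnoise
  have hpastm : Measurable fun ω (q : A) => η q.1.1 q.1.2 ω :=
    measurable_pi_lambda _ fun q => hnoise q.1
  have hpresm : Measurable fun ω (q : B) => η q.1.1 q.1.2 ω :=
    measurable_pi_lambda _ fun q => hnoise q.1
  have hsplit : Measurable fun w : ℕ → Fin N → Space d =>
      ((fun q : A => w q.1.1 q.1.2), (fun q : B => w q.1.1 q.1.2)) := by fun_prop
  have htriple : IndepFun x0
      (fun ω => ((fun q : A => η q.1.1 q.1.2 ω), (fun q : B => η q.1.1 q.1.2 ω))) P :=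
    hin.init_indep_noise.comp measurable_id hsplit
  have hind := indepFun_prodMk_of_indepFun_prodMk hin.measurable_init hpastm hpresm htriple hpp
  have hBmem : ∀ i, (n, i) ∈ B := fun i => by simp [hB]
  -- Noises from time `n` on are filled with zero; by `iterates_congr` they do not affect the
  -- iterate at `n`.
  set ext : (A → Space d) → ℕ → Fin N → Space d :=
    fun w k i => if h : (k, i) ∈ A then w ⟨(k, i), h⟩ else 0 with hext
  have hextm : Measurable ext := by
    refine measurable_pi_lambda _ fun k => measurable_pi_lambda _ fun i => ?_
    by_cases h : (k, i) ∈ A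
    · simp only [hext, h, dite_true]
      exact measurable_pi_apply _
    · simp only [hext, h, dite_false]
      exact measurable_const
  have hφ : Measurable fun q : (Fin N → Space d) × (A → Space d) =>
      (q.1, iterates f S γ₁ γ₂ q.1 (ext q.2) n) :=
    measurable_fst.prodMk ((measurable_iterates (γ₁ := γ₁) (γ₂ := γ₂) hcl hf n).comp
      (measurable_fst.prodMk (hextm.comp measurable_snd)))
  have hψ : Measurable fun (w : B → Space d) (i : Fin N) => w ⟨(n, i), hBmem i⟩ :=
    measurable_pi_lambda _ fun i => measurable_pi_apply _
  have hres := hind.comp hφ hψ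
  have heq : (fun ω => (x0 ω, iterates f S γ₁ γ₂ (x0 ω) (fun k i => η k i ω) n)) =
      (fun q : (Fin N → Space d) × (A → Space d) =>
        (q.1, iterates f S γ₁ γ₂ q.1 (ext q.2) n)) ∘
      fun ω => (x0 ω, fun q : A => η q.1.1 q.1.2 ω) := by
    funext ω
    refine Prod.ext rfl (iterates_congr _ fun k hk => funext fun i => ?_)
    have : (k, i) ∈ A := by simp [hA, hk]
    simp only [hext, this, dite_true]
  rw [heq]
  exact hres

theorem lintegral_iterates_noise (hcl : IsClosed S) (hf : Measurable f)
    (hin : IsInput P S x0 η) (n : ℕ)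
    {g : ((Fin N → Space d) × (Fin N → Space d)) × (Fin N → Space d) → ℝ≥0∞}
    (hg : Measurable g) :
    ∫⁻ ω, g ((x0 ω, iterates f S γ₁ γ₂ (x0 ω) (fun k i => η k i ω) n), fun i => η n i ω) ∂P =
      ∫⁻ ω, ∫⁻ e, g ((x0 ω, iterates f S γ₁ γ₂ (x0 ω) (fun k i => η k i ω) n), e)
        ∂(P.map fun ω i => η n i ω) ∂P := by
  have hηm : Measurable fun ω k i => η k i ω :=
    measurable_pi_lambda _ fun k => measurable_pi_lambda _ fun i => hin.measurable_noise k i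
  have hηn : Measurable fun ω i => η n i ω := (measurable_pi_apply n).comp hηm
  have hY : Measurable fun ω =>
      (x0 ω, iterates f S γ₁ γ₂ (x0 ω) (fun k i => η k i ω) n) :=
    hin.measurable_init.prodMk
      ((measurable_iterates (γ₁ := γ₁) (γ₂ := γ₂) hcl hf n).comp (hin.measurable_init.prodMk hηm))
  have hlaw := (indepFun_iff_map_prod_eq_prod_map_map hY.aemeasurable hηn.aemeasurable).1
    (indepFun_iterates_noise (γ₁ := γ₁) (γ₂ := γ₂) hcl hf hin n)
  rw [← lintegral_map hg (hY.prodMk hηn), hlaw, lintegral_prod _ hg.aemeasurable,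
    lintegral_map hg.lintegral_prod_right' hY]

/-- Multiplied by the indicator of an initial event, the Lyapunov inequality telescopes. The
expected sum of all spreads is finite there, so almost surely the series converges and its terms
vanish. -/
theorem ae_tendsto_spread (hd : d ≠ 0) (hcl : IsClosed S) (hf : Measurable f)
    (hdom : ∀ x, f x < ⊤ ↔ x ∈ S) (h1 : γ₁ < 1) (h2 : 0 < γ₂)
    (hγ : (1 - γ₁ + γ₂) ^ 2 ≤ 1 / 2) (hin : IsInput P S x0 η) {R : ℝ} (hR : 0 ≤ R) (m : ℝ) :
    ∀ᵐ ω ∂P, Good f S R (x0 ω) → (∀ i, ‖x0 ω i‖ ≤ m) →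
      Tendsto (fun n => spread f (iterates f S γ₁ γ₂ (x0 ω) (fun k i => η k i ω) n))
        atTop (𝓝 0) := by
  obtain ⟨ρ, H, c, hc, hlyap⟩ := exists_lyapunov (N := N) hd hcl hf h1 h2 hγ hR
  set X : ℕ → Ω → Fin N → Space d :=
    fun n ω => iterates f S γ₁ γ₂ (x0 ω) (fun k i => η k i ω) n with hX
  have hηm : Measurable fun ω k i => η k i ω :=
    measurable_pi_lambda _ fun k => measurable_pi_lambda _ fun i => hin.measurable_noise k i
  have hXm : ∀ n, Measurable (X n) := fun n =>
    (measurable_iterates (γ₁ := γ₁) (γ₂ := γ₂) hcl hf n).comp (hin.measurable_init.prodMk hηm)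
  -- The event concerns the initial configuration only. The bound `m` makes the initial Lyapunov
  -- value bounded, and `good_iterates` carries the sublevel condition to later times.
  set G : Set (Fin N → Space d) := {x | Good f S R x} ∩ ⋂ i, {x | ‖x i‖ ≤ m} with hG
  have hGm : MeasurableSet G := (measurableSet_good hcl hf R).inter
    (MeasurableSet.iInter fun i => measurableSet_le (measurable_pi_apply i).norm measurable_const)
  set ind : (Fin N → Space d) → ℝ≥0∞ := G.indicator 1 with hind
  have hindm : Measurable ind := measurable_one.indicator hGm
  set Ψ : (Fin N → Space d) → ℝ≥0∞ :=
    fun x => spread f x + ENNReal.ofReal H * improveVol f S ρ x with hΨ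
  have hΨm : Measurable Ψ :=
    (measurable_spread hf).add ((measurable_improveVol hcl hf ρ).const_mul _)
  have hWm : ∀ n, Measurable fun ω => ind (x0 ω) * (ENNReal.ofReal c * spread f (X n ω)) :=
    fun n => (hindm.comp hin.measurable_init).mul
      (((measurable_spread hf).comp (hXm n)).const_mul _)
  have hstep : ∀ n, ∫⁻ ω, ind (x0 ω) * Ψ (X (n + 1) ω) ∂P +
      ∫⁻ ω, ind (x0 ω) * (ENNReal.ofReal c * spread f (X n ω)) ∂P
      ≤ ∫⁻ ω, ind (x0 ω) * Ψ (X n ω) ∂P := by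
    intro n
    have hηn : Measurable fun ω i => η n i ω := (measurable_pi_apply n).comp hηm
    have hprob : IsProbabilityMeasure (P.map fun ω i => η n i ω) :=
      Measure.isProbabilityMeasure_map hηn.aemeasurable
    have hmarg : ∀ j, (P.map fun ω i => η n i ω).map (fun e : Fin N → Space d => e j)
        = stdGaussian (Space d) := by
      intro j
      rw [Measure.map_map (measurable_pi_apply j) hηn]
      exact hin.noise_law n j
    have hm1 : Measurable
        fun q : ((Fin N → Space d) × (Fin N → Space d)) × (Fin N → Space d) => (q.1.2, q.2) := by
      fun_prop
    have hm2 : Measurable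
        fun q : ((Fin N → Space d) × (Fin N → Space d)) × (Fin N → Space d) => q.1.1 := by
      fun_prop
    have hm3 : Measurable
        fun q : (Fin N → Space d) × (Fin N → Space d) => Ψ (step f S γ₁ γ₂ q.1 q.2) :=
      hΨm.comp (measurable_step hcl hf)
    have hm4 := (hindm.comp hm2).mul (hm3.comp hm1)
    have hgm : Measurable
        fun q : ((Fin N → Space d) × (Fin N → Space d)) × (Fin N → Space d) =>
          ind q.1.1 * Ψ (step f S γ₁ γ₂ q.1.2 q.2) := hm4
    have hnext := lintegral_iterates_noise (γ₁ := γ₁) (γ₂ := γ₂) hcl hf hin n hgm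
    have hnext' : ∫⁻ ω, ind (x0 ω) * Ψ (X (n + 1) ω) ∂P =
        ∫⁻ ω, ∫⁻ e, ind (x0 ω) * Ψ (step f S γ₁ γ₂ (X n ω) e) ∂(P.map fun ω i => η n i ω) ∂P :=
      hnext
    rw [hnext', ← lintegral_add_right _ (hWm n)]
    refine lintegral_mono fun ω => ?_
    by_cases hω : x0 ω ∈ G
    · have hi : ind (x0 ω) = 1 := by simp [hind, hω]
      simp only [hi, one_mul]
      exact hlyap (X n ω) (good_iterates hdom hω.1 _ n) _ hmarg
    · have hi : ind (x0 ω) = 0 := by simp [hind, hω]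
      simp [hi]
  have htele : ∀ n, ∫⁻ ω, ind (x0 ω) * Ψ (X n ω) ∂P +
      ∑ k ∈ Finset.range n, ∫⁻ ω, ind (x0 ω) * (ENNReal.ofReal c * spread f (X k ω)) ∂P
      ≤ ∫⁻ ω, ind (x0 ω) * Ψ (x0 ω) ∂P := by
    intro n
    induction n with
    | zero => simp [hX, iterates]
    | succ n ih =>
      rw [Finset.sum_range_succ, add_comm (∑ k ∈ Finset.range n, _), ← add_assoc]
      exact (add_le_add (hstep n) le_rfl).trans ih
  have hinit : ∫⁻ ω, ind (x0 ω) * Ψ (x0 ω) ∂P < ∞ := by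
    have hb : ∀ ω, ind (x0 ω) * Ψ (x0 ω) ≤ ∑ _i : Fin N, ENNReal.ofReal ((m + R) ^ d) +
        ENNReal.ofReal H * ∑ _k : Fin N, volume (Metric.closedBall (0 : Space d) ρ) := by
      intro ω
      by_cases hω : x0 ω ∈ G
      · have hi : ind (x0 ω) = 1 := by simp [hind, hω]
        rw [hi, one_mul]
        refine add_le_add (Finset.sum_le_sum fun i _ => ENNReal.ofReal_le_ofReal
          (pow_le_pow_left₀ (norm_nonneg _) ?_ d))
          (mul_le_mul_right (Finset.sum_le_sum fun k _ => measure_mono Set.inter_subset_right) _)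
        have h3 : best f (x0 ω) ∈ Metric.closedBall 0 R := hω.1.2 (le_refl (f (best f (x0 ω))))
        rw [mem_closedBall_zero_iff] at h3
        have h4 : ‖x0 ω i‖ ≤ m := Set.mem_iInter.1 hω.2 i
        linarith [norm_sub_le (x0 ω i) (best f (x0 ω))]
      · have hi : ind (x0 ω) = 0 := by simp [hind, hω]
        simp [hi]
    refine (lintegral_mono hb).trans_lt ?_
    rw [lintegral_const, measure_univ, mul_one]
    refine ENNReal.add_lt_top.2 ⟨ENNReal.sum_lt_top.2 fun _ _ => ENNReal.ofReal_lt_top,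
      ENNReal.mul_lt_top ENNReal.ofReal_lt_top
        (ENNReal.sum_lt_top.2 fun _ _ => measure_closedBall_lt_top)⟩
  have hsum : ∫⁻ ω, ∑' n, ind (x0 ω) * (ENNReal.ofReal c * spread f (X n ω)) ∂P ≠ ∞ := by
    rw [lintegral_tsum fun n => (hWm n).aemeasurable]
    refine ((ENNReal.tsum_le_of_sum_range_le fun n => ?_).trans_lt hinit).ne
    exact le_trans le_add_self (htele n)
  filter_upwards [ae_lt_top (Measurable.tsum hWm) hsum] with ω hω hgood hm
  have hi : ind (x0 ω) = 1 := by
    have : x0 ω ∈ G := ⟨hgood, Set.mem_iInter.2 hm⟩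
    simp [hind, this]
  simp only [hi, one_mul] at hω
  rw [ENNReal.tsum_mul_left] at hω
  have hc0 : ENNReal.ofReal c ≠ 0 := (ENNReal.ofReal_pos.2 hc).ne'
  refine ENNReal.tendsto_atTop_zero_of_tsum_ne_top fun htop => ?_
  rw [htop, ENNReal.mul_top hc0] at hω
  exact lt_irrefl _ hω

/-- Almost every path with bounded initial sublevel set reaches a consensus. -/
theorem ae_consensus (hcl : IsClosed S) (hf : Measurable f)
    (hdom : ∀ x, f x < ⊤ ↔ x ∈ S) (hγ₁ : γ₁ ∈ Set.Ioo (0 : ℝ) 1) (hγ₂ : 0 ≤ γ₂)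
    (hγ : (1 - γ₁ + γ₂) ^ 2 ≤ 1 / 2) (hin : IsInput P S x0 η) :
    ∀ᵐ ω ∂P, Bornology.IsBounded (initialSublevel f S (x0 ω)) →
      Consensus (iterates f S γ₁ γ₂ (x0 ω) fun n i => η n i ω) := by
  -- In dimension zero `D^d` is one even at `D = 0`, so the spread does not detect consensus.
  rcases eq_or_ne d 0 with rfl | hd
  · refine ae_of_all _ fun ω _ i j => ?_
    simp [Subsingleton.elim (_ : Space 0) 0]
  -- Without diffusion proposals have no density, but the distances contract deterministically.
  rcases hγ₂.eq_or_lt with rfl | hγ₂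
  · exact ae_of_all _ fun ω _ => consensus_of_noiseless hcl hγ₁ _ _
  -- Natural bounds `R` and `m` exhaust the paths in question by countably many events.
  have hall : ∀ᵐ ω ∂P, ∀ R m : ℕ, Good f S R (x0 ω) → (∀ i, ‖x0 ω i‖ ≤ m) →
      Tendsto (fun n => spread f (iterates f S γ₁ γ₂ (x0 ω) (fun k i => η k i ω) n))
        atTop (𝓝 0) :=
    ae_all_iff.2 fun R => ae_all_iff.2 fun m =>
      ae_tendsto_spread hd hcl hf hdom hγ₁.2 hγ₂ hγ hin R.cast_nonneg m
  filter_upwards [hall, hin.init_mem] with ω hω hinit hbdd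
  obtain ⟨r, hr⟩ := hbdd.subset_closedBall 0
  obtain ⟨R, hR⟩ := exists_nat_ge r
  obtain ⟨m, hm⟩ := exists_nat_ge (∑ i, ‖x0 ω i‖)
  have hbest : best f (x0 ω) ∈ S := hinit _
  refine consensus_of_tendsto_spread (hω R m ⟨hbest, fun y hy => ?_⟩ fun i => ?_)
  · have hy' : f y ≤ f (best f (x0 ω)) := hy
    refine Metric.closedBall_subset_closedBall hR (hr ⟨?_, ?_⟩)
    · exact (hdom y).1 (hy'.trans_lt ((hdom _).2 hbest))
    · rwa [best_eq_iInf]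
  · exact (Finset.single_le_sum (f := fun i => ‖x0 ω i‖) (fun _ _ => norm_nonneg _)
      (Finset.mem_univ i)).trans hm

end Random

end DCBO


theorem theorem3p5 {d N : ℕ} [NeZero N]
    {Ω : Type*} [MeasurableSpace Ω] (P : Measure Ω) [IsProbabilityMeasure P]
    (S : Set (DCBO.Space d)) (hS : IsClosed S)
    (f : DCBO.Space d → EReal) (hf : Measurable f)
    (hf_bot : ∀ x, f x ≠ ⊥) (hf_dom : ∀ x, f x < ⊤ ↔ x ∈ S)
    (γ₁ γ₂ : ℝ) (hγ₁ : γ₁ ∈ Set.Ioo (0 : ℝ) 1) (hγ₂ : 0 ≤ γ₂)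
    (hγ : (1 - γ₁ + γ₂) ^ 2 ≤ 1 / 2)
    (x0 : Ω → Fin N → DCBO.Space d) (η : ℕ → Fin N → Ω → DCBO.Space d)
    (hinput : DCBO.IsInput P S x0 η)
    (X : Ω → ℕ → Fin N → DCBO.Space d)
    (hX : ∀ ω, X ω = DCBO.iterates f S γ₁ γ₂ (x0 ω) (fun n i => η n i ω)) :
    (∀ᵐ ω ∂P, Bornology.IsBounded (DCBO.initialSublevel f S (x0 ω)) →
      ∃ L : EReal, Tendsto (fun n => f (DCBO.best f (X ω n))) atTop (𝓝 L) ∧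
        (L ≤ essInf f volume ∨ DCBO.Consensus (X ω))) ∧
    (∀ xstar ∈ S, ContinuousOn f S → (∀ y ∈ S, y ≠ xstar → f xstar < f y) →
      essInf f volume = f xstar →
      ∀ᵐ ω ∂P, Bornology.IsBounded (DCBO.initialSublevel f S (x0 ω)) →
        DCBO.Consensus (X ω)) := by
  have hcons := DCBO.ae_consensus hS hf hf_dom hγ₁ hγ₂ hγ hinput
  simp only [hX]
  refine ⟨?_, fun _ _ _ _ _ => hcons⟩
  filter_upwards [hcons, hinput.init_mem] with ω hω hinit hbdd
  -- The best values are nonincreasing, so they converge to their infimum in `EReal`.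
  exact ⟨_, tendsto_atTop_iInf (DCBO.best_iterates_antitone hf_dom (hinit _) _),
    Or.inr (hω hbdd)⟩
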